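/- Let $m_1,m_2,n$ be nonnegative integers, $m=m_1+m_2$, let $\|\cdot\|$ be the matrix norm induced by the $\ell^2$ vector norms, and put $j=\operatorname{diag}(I_{m_1},-I_{m_2})$. For a function $v:[0,\infty)\to\mathbb C^{m_1\times m_2}$ consider the skew-selfadjoint Dirac system $$\frac{d}{dx}y(x,z)=\bigl(izj+jV(x)\bigr)y(x,z)\quad(x\ge 0,\ z\in\mathbb C),\qquad V=\begin{bmatrix}0&v\\ v^*&0\end{bmatrix},$$ and let $u(x,z)$ be its $m\times m$ fundamental solution normalized by $u(0,z)=I_m$. If $M>0$ and $\|v(x)\|\le M$ for all $x\ge 0$, a meromorphic $m_2\times m_1$ matrix function $\varphi$ on $\mathbb C_M=\{z:\operatorname{Im}z>M\}$ is called a Weyl function of the system if $$\int_0^\infty\begin{bmatrix}I_{m_1}&\varphi(z)^*\end{bmatrix}u(x,z)^*u(x,z)\begin{bmatrix}I_{m_1}\\ \varphi(z)\end{bmatrix}dx<\infty\qquad\text{for all } z\in\mathbb C_M .$$ Let $\{\alpha,S_0,\vartheta_1,\vartheta_2\}$ be an admissible quadruple, that is, $\alpha,S_0\in\mathbb C^{n\times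 n}$, $\vartheta_1\in\mathbb C^{n\times m_1}$, $\vartheta_2\in\mathbb C^{n\times m_2}$, $S_0$ is positive definite, and $\alpha S_0-S_0\alpha^*=i(\vartheta_1\vartheta_1^*+\vartheta_2\vartheta_2^*)$. Let $$v(x)=2\vartheta_1^*e^{ix\alpha^*}S(x)^{-1}e^{ix\alpha}\vartheta_2,\qquad S(x)=S_0+\int_0^x\Lambda(t)j\Lambda(t)^*\,dt,\qquad \Lambda(x)=\begin{bmatrix}e^{-ix\alpha}\vartheta_1&e^{ix\alpha}\vartheta_2\end{bmatrix},$$ be the pseudo-exponential potential generated by this quadruple. Then $v$ is bounded on $[0,\infty)$, and for every $M>0$ with $\|v(x)\|\le M$ for all $x\ge0$ the Dirac system with potential $v$ has a Weyl function on $\mathbb C_M$, and every Weyl function $\varphi$ on $\mathbb C_M$ is given by $$\varphi(z)=i\vartheta_2^*S_0^{-1}(zI_n-\alpha^\times)^{-1}\vartheta_1,\qquad \alpha^\times:=\alpha-i\vartheta_1\vartheta_1^*S_0^{-1},\qquad z\in\mathbb C_M\setminus\sigma(\alpha^\times).$$ -/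

import Mathlib

/- Matrices carry the norm induced by the Euclidean (`ℓ²`) vector norms. -/
open scoped Matrix Matrix.Norms.L2Operator ComplexOrder

noncomputable section

namespace SkewDirac

/-- The signature matrix `j = diag(I_{m₁}, -I_{m₂})`. -/
def signature (m₁ m₂ : ℕ) : Matrix (Fin m₁ ⊕ Fin m₂) (Fin m₁ ⊕ Fin m₂) ℂ :=
  Matrix.fromBlocks 1 0 0 (-1)

/-- The matrix `V = [[0, v], [v*, 0]]`. -/
def offDiag {m₁ m₂ : ℕ} (v : Matrix (Fin m₁) (Fin m₂) ℂ) :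
    Matrix (Fin m₁ ⊕ Fin m₂) (Fin m₁ ⊕ Fin m₂) ℂ :=
  Matrix.fromBlocks 0 v vᴴ 0

/-- The coefficient `i z j + j V(x)` of the skew-selfadjoint Dirac system with potential `v`. -/
def coefficient {m₁ m₂ : ℕ} (v : ℝ → Matrix (Fin m₁) (Fin m₂) ℂ) (x : ℝ) (z : ℂ) :
    Matrix (Fin m₁ ⊕ Fin m₂) (Fin m₁ ⊕ Fin m₂) ℂ :=
  (Complex.I * z) • signature m₁ m₂ + signature m₁ m₂ * offDiag (v x)

/-- `u` is the fundamental solution of `y' = (i z j + j V) y` on the half-line `x ≥ 0`,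
normalized by `u(0, z) = I`, for all `z ∈ ℂ`. Only the values `u x z` with `x ≥ 0` matter. -/
structure IsFundamentalSolution {m₁ m₂ : ℕ} (v : ℝ → Matrix (Fin m₁) (Fin m₂) ℂ)
    (u : ℝ → ℂ → Matrix (Fin m₁ ⊕ Fin m₂) (Fin m₁ ⊕ Fin m₂) ℂ) : Prop where
  initial : ∀ z : ℂ, u 0 z = 1
  deriv : ∀ z : ℂ, ∀ x : ℝ, 0 ≤ x →
    HasDerivWithinAt (fun s => u s z) (coefficient v x z * u x z) (Set.Ici 0) x

/-- The open half-plane `ℂ_M = {z : Im z > M}`. -/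
def upperHalf (M : ℝ) : Set ℂ := {z | M < z.im}

/-- The potential satisfies `‖v(x)‖ ≤ M` for all `x ≥ 0`. -/
def IsBoundedBy {m₁ m₂ : ℕ} (v : ℝ → Matrix (Fin m₁) (Fin m₂) ℂ) (M : ℝ) : Prop :=
  ∀ x : ℝ, 0 ≤ x → ‖v x‖ ≤ M

/-- `φ` is a Weyl function on `ℂ_M` of the skew-selfadjoint Dirac system with potential `v`:
an `m₂ × m₁` matrix function, meromorphic on `ℂ_M`, such that
`∫₀^∞ [I φ(z)*] u(x,z)* u(x,z) [I; φ(z)] dx < ∞` for every `z ∈ ℂ_M`, where `u` is the normalized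
fundamental solution. -/
structure IsWeylFunction {m₁ m₂ : ℕ} (v : ℝ → Matrix (Fin m₁) (Fin m₂) ℂ) (M : ℝ)
    (φ : ℂ → Matrix (Fin m₂) (Fin m₁) ℂ) : Prop where
  meromorphic : MeromorphicOn φ (upperHalf M)
  integrable : ∃ u : ℝ → ℂ → Matrix (Fin m₁ ⊕ Fin m₂) (Fin m₁ ⊕ Fin m₂) ℂ,
    IsFundamentalSolution v u ∧
    ∀ z ∈ upperHalf M, MeasureTheory.IntegrableOn
      (fun x : ℝ => Matrix.fromCols (1 : Matrix (Fin m₁) (Fin m₁) ℂ) (φ z)ᴴ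
        * (u x z)ᴴ * u x z * Matrix.fromRows (1 : Matrix (Fin m₁) (Fin m₁) ℂ) (φ z))
      (Set.Ici 0)

/-- The data `{α, S₀, ϑ₁, ϑ₂}`. -/
structure Quadruple (n m₁ m₂ : ℕ) where
  α : Matrix (Fin n) (Fin n) ℂ
  S₀ : Matrix (Fin n) (Fin n) ℂ
  ϑ₁ : Matrix (Fin n) (Fin m₁) ℂ
  ϑ₂ : Matrix (Fin n) (Fin m₂) ℂ

namespace Quadruple

variable {n m₁ m₂ : ℕ}

/-- Admissibility: `S₀ > 0` and `α S₀ - S₀ α* = i (ϑ₁ ϑ₁* + ϑ₂ ϑ₂*)`. -/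
structure IsAdmissible (Q : Quadruple n m₁ m₂) : Prop where
  posDef : Q.S₀.PosDef
  identity : Q.α * Q.S₀ - Q.S₀ * Q.αᴴ = Complex.I • (Q.ϑ₁ * Q.ϑ₁ᴴ + Q.ϑ₂ * Q.ϑ₂ᴴ)

/-- `Λ(x) = [e^{-ixα} ϑ₁, e^{ixα} ϑ₂]`. -/
def Lam (Q : Quadruple n m₁ m₂) (x : ℝ) : Matrix (Fin n) (Fin m₁ ⊕ Fin m₂) ℂ :=
  Matrix.fromCols (NormedSpace.exp ((-(Complex.I * (x : ℂ))) • Q.α) * Q.ϑ₁)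
    (NormedSpace.exp ((Complex.I * (x : ℂ)) • Q.α) * Q.ϑ₂)

/-- `S(x) = S₀ + ∫₀ˣ Λ(t) j Λ(t)* dt`. -/
def S (Q : Quadruple n m₁ m₂) (x : ℝ) : Matrix (Fin n) (Fin n) ℂ :=
  Q.S₀ + ∫ t in (0 : ℝ)..x, Q.Lam t * signature m₁ m₂ * (Q.Lam t)ᴴ

/-- The pseudo-exponential potential `v(x) = 2 ϑ₁* e^{ixα*} S(x)⁻¹ e^{ixα} ϑ₂`
generated by the quadruple. -/
def potential (Q : Quadruple n m₁ m₂) (x : ℝ) : Matrix (Fin m₁) (Fin m₂) ℂ :=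
  (2 : ℂ) • (Q.ϑ₁ᴴ * NormedSpace.exp ((Complex.I * (x : ℂ)) • Q.αᴴ) * (Q.S x)⁻¹
    * NormedSpace.exp ((Complex.I * (x : ℂ)) • Q.α) * Q.ϑ₂)

/-- `α^× = α - i ϑ₁ ϑ₁* S₀⁻¹`. -/
def αCross (Q : Quadruple n m₁ m₂) : Matrix (Fin n) (Fin n) ℂ :=
  Q.α - Complex.I • (Q.ϑ₁ * Q.ϑ₁ᴴ * Q.S₀⁻¹)

end Quadruple

end SkewDirac

end

/-! The identity `α S(x) - S(x) α* = i Λ(x) Λ(x)*` persists from `x = 0` to all `x` (`identity_S`).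
Conjugating by `e^{ixα}` turns the indefinite integral in `S` into `e^{2ixα} S₀ e^{-2ixα*}` plus
twice a Gramian of `(α, ϑ₁)` (`flow_mul_S_mul_flow`), so `S(x) > 0` for `x ≥ 0`. By the identity the
positive semidefinite matrix `Λ* S⁻¹ Λ` has constant trace (`trace_weight`), so its entries are
bounded; its upper right block is `v/2`.

If `(α - z) G = ϑ₁ C`, then `Y = [e^{izx} C; 0] - i Λ* S⁻¹ g` with `g = e^{-ix(α-z)} G` solves the
system, and `Y* Y = e^{-2 Im z x} C* C + 2 Im z g* S⁻¹ g`. If moreover `G` has its columns in the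
range `W` of the Gramian over `[0,1]`, then the growth of `S` forces `g* S⁻¹ g` to decay like `e^{-2
Im z x}` (`re_dotProduct_inv_S_le`), and `Y` is square integrable.

Conversely, when `Im z > M ≥ ‖v‖`, the squared norm of the lower part of a solution minus that of
the upper part is nondecreasing, so a square integrable solution with zero upper initial value has
zero initial value (`eq_zero_of_integrableOn`). This gives uniqueness, and also existence: the
admissible pairs `(c, g)` with `g ∈ W` form a space of dimension at least `m₁`, on which the upper
initial value is injective, hence bijective (`exists_decaying_vector`). No invertibility of `α - z`
is needed. Normalizing the upper initial value to `I` gives `(z - α^×) G = -ϑ₁`, and the lower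
initial value `-i ϑ₂* S₀⁻¹ G` becomes the stated formula for `φ`. -/

noncomputable section

/-! ### Differential calculus for matrix-valued functions -/

section MatrixCalculus

variable {l m n : Type*} [Fintype l] [Fintype m] [Fintype n] [DecidableEq m] [DecidableEq n]

/-- Rectangular matrices do not form a normed ring, so the product rule below is reduced to scalar
entries. Entry maps and matrix units are continuous linear, which gives the two directions. -/
theorem hasDerivWithinAt_matrix {A : ℝ → Matrix m n ℂ} {A' : Matrix m n ℂ} {s : Set ℝ} {x : ℝ} :
    HasDerivWithinAt A A' s x ↔ ∀ i j, HasDerivWithinAt (fun t => A t i j) (A' i j) s x := by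
  constructor
  · intro h i j
    exact ((LinearMap.toContinuousLinearMap
      (Matrix.entryLinearMap ℝ ℂ i j : Matrix m n ℂ →ₗ[ℝ] ℂ)).hasFDerivAt.comp_hasDerivWithinAt x h)
  · intro h
    have h1 : HasDerivWithinAt (fun t => ∑ i, ∑ j, Matrix.single i j (A t i j))
        (∑ i, ∑ j, Matrix.single i j (A' i j)) s x := by
      refine HasDerivWithinAt.fun_sum fun i _ => HasDerivWithinAt.fun_sum fun j _ => ?_
      exact ((LinearMap.toContinuousLinearMap
        (Matrix.singleLinearMap ℝ i j : ℂ →ₗ[ℝ] Matrix m n ℂ)).hasFDerivAt.comp_hasDerivWithinAt x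
          (h i j))
    simpa only [← Matrix.matrix_eq_sum_single] using h1

variable [DecidableEq l]

theorem HasDerivWithinAt.matrix_mul {A : ℝ → Matrix l m ℂ} {A' : Matrix l m ℂ}
    {B : ℝ → Matrix m n ℂ} {B' : Matrix m n ℂ} {s : Set ℝ} {x : ℝ}
    (hA : HasDerivWithinAt A A' s x) (hB : HasDerivWithinAt B B' s x) :
    HasDerivWithinAt (fun t => A t * B t) (A' * B x + A x * B') s x := by
  rw [hasDerivWithinAt_matrix] at *
  intro i j
  simp only [Matrix.mul_apply, Matrix.add_apply, ← Finset.sum_add_distrib]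
  exact HasDerivWithinAt.fun_sum fun k _ => (hA i k).fun_mul (hB k j)

theorem HasDerivWithinAt.matrix_conjTranspose {A : ℝ → Matrix l m ℂ} {A' : Matrix l m ℂ}
    {s : Set ℝ} {x : ℝ} (hA : HasDerivWithinAt A A' s x) :
    HasDerivWithinAt (fun t => (A t)ᴴ) A'ᴴ s x := by
  rw [hasDerivWithinAt_matrix] at *
  intro i j
  exact (hA j i).star

theorem HasDerivWithinAt.matrix_inv {A : ℝ → Matrix n n ℂ} {A' : Matrix n n ℂ}
    {s : Set ℝ} {x : ℝ} (hA : HasDerivWithinAt A A' s x) (hu : IsUnit (A x)) :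
    HasDerivWithinAt (fun t => (A t)⁻¹) (-((A x)⁻¹ * A' * (A x)⁻¹)) s x := by
  obtain ⟨u, hu⟩ := hu
  have h := hasFDerivAt_ringInverse (𝕜 := ℝ) u
  rw [hu] at h
  have h2 := h.comp_hasDerivWithinAt x hA
  have e : (↑u⁻¹ : Matrix n n ℂ) = (A x)⁻¹ := by
    rw [← hu, Matrix.coe_units_inv]
  simp only [Matrix.nonsing_inv_eq_ringInverse] at *
  simpa [Function.comp_def, e] using h2

theorem HasDerivAt.matrix_mul {A : ℝ → Matrix l m ℂ} {A' : Matrix l m ℂ}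
    {B : ℝ → Matrix m n ℂ} {B' : Matrix m n ℂ} {x : ℝ}
    (hA : HasDerivAt A A' x) (hB : HasDerivAt B B' x) :
    HasDerivAt (fun t => A t * B t) (A' * B x + A x * B') x := by
  rw [← hasDerivWithinAt_univ] at *
  exact hA.matrix_mul hB

theorem HasDerivAt.matrix_conjTranspose {A : ℝ → Matrix l m ℂ} {A' : Matrix l m ℂ} {x : ℝ}
    (hA : HasDerivAt A A' x) : HasDerivAt (fun t => (A t)ᴴ) A'ᴴ x := by
  rw [← hasDerivWithinAt_univ] at *
  exact hA.matrix_conjTranspose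

theorem HasDerivAt.matrix_inv {A : ℝ → Matrix n n ℂ} {A' : Matrix n n ℂ} {x : ℝ}
    (hA : HasDerivAt A A' x) (hu : IsUnit (A x)) :
    HasDerivAt (fun t => (A t)⁻¹) (-((A x)⁻¹ * A' * (A x)⁻¹)) x := by
  rw [← hasDerivWithinAt_univ] at *
  exact hA.matrix_inv hu

theorem HasDerivWithinAt.matrix_fromRows {A : ℝ → Matrix l n ℂ} {A' : Matrix l n ℂ}
    {B : ℝ → Matrix m n ℂ} {B' : Matrix m n ℂ} {s : Set ℝ} {x : ℝ}
    (hA : HasDerivWithinAt A A' s x) (hB : HasDerivWithinAt B B' s x) :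
    HasDerivWithinAt (fun t => Matrix.fromRows (A t) (B t)) (Matrix.fromRows A' B') s x := by
  rw [hasDerivWithinAt_matrix] at *
  rintro (i | i) j
  · exact hA i j
  · exact hB i j

theorem HasDerivWithinAt.matrix_fromCols {A : ℝ → Matrix n l ℂ} {A' : Matrix n l ℂ}
    {B : ℝ → Matrix n m ℂ} {B' : Matrix n m ℂ} {s : Set ℝ} {x : ℝ}
    (hA : HasDerivWithinAt A A' s x) (hB : HasDerivWithinAt B B' s x) :
    HasDerivWithinAt (fun t => Matrix.fromCols (A t) (B t)) (Matrix.fromCols A' B') s x := by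
  rw [hasDerivWithinAt_matrix] at *
  rintro i (j | j)
  · exact hA i j
  · exact hB i j

theorem hasDerivAt_exp_mul_smul (c : ℂ) (A : Matrix n n ℂ) (x : ℝ) :
    HasDerivAt (fun t : ℝ => NormedSpace.exp ((c * (t : ℂ)) • A))
      (c • (A * NormedSpace.exp ((c * (x : ℂ)) • A))) x := by
  have h := (hasDerivAt_exp_smul_const' (𝕂 := ℝ) (c • A) x)
  have e : ∀ t : ℝ, t • c • A = (c * (t : ℂ)) • A := by
    intro t
    rw [mul_comm, mul_smul]
    ext i j
    simp
  simpa only [e, smul_mul_assoc] using h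

theorem exp_smul_conjTranspose (c : ℂ) (A : Matrix n n ℂ) :
    (NormedSpace.exp (c • A))ᴴ = NormedSpace.exp (star c • Aᴴ) := by
  rw [← Matrix.exp_conjTranspose, Matrix.conjTranspose_smul]

theorem exp_smul_mul_exp_smul (a b : ℂ) (A : Matrix n n ℂ) :
    NormedSpace.exp (a • A) * NormedSpace.exp (b • A) = NormedSpace.exp ((a + b) • A) := by
  rw [add_smul, Matrix.exp_add_of_commute]
  exact (Commute.refl A).smul_left a |>.smul_right b

end MatrixCalculus

/-! ### Linear differential equations: the Dyson series -/

section LinearODE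

open MeasureTheory

variable {𝔸 : Type*} [NormedRing 𝔸] [NormedAlgebra ℝ 𝔸]

/-- The terms of the Dyson series of `U' = A U`, `U(0) = 1`. -/
def dysonTerm (A : ℝ → 𝔸) : ℕ → ℝ → 𝔸
  | 0 => fun _ => 1
  | k + 1 => fun x => ∫ t in (0 : ℝ)..x, A t * dysonTerm A k t

theorem continuous_dysonTerm {A : ℝ → 𝔸} (hA : Continuous A) (k : ℕ) :
    Continuous (dysonTerm A k) := by
  induction k with
  | zero => exact continuous_const
  | succ k ih =>
    exact intervalIntegral.continuous_primitive
      (fun a b => (hA.mul ih).intervalIntegrable a b) 0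

theorem hasDerivAt_dysonTerm_succ [CompleteSpace 𝔸] {A : ℝ → 𝔸} (hA : Continuous A) (k : ℕ) (x : ℝ) :
    HasDerivAt (dysonTerm A (k + 1)) (A x * dysonTerm A k x) x := by
  have hc := hA.mul (continuous_dysonTerm hA k)
  exact intervalIntegral.integral_hasDerivAt_right (hc.intervalIntegrable _ _)
    hc.aestronglyMeasurable.stronglyMeasurableAtFilter hc.continuousAt

theorem norm_dysonTerm_le {A : ℝ → 𝔸} (hA : Continuous A) {C T : ℝ}
    (hC : ∀ x, |x| ≤ T → ‖A x‖ ≤ C) (k : ℕ) (x : ℝ) (hx : |x| ≤ T) :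
    ‖dysonTerm A k x‖ ≤ ‖(1 : 𝔸)‖ * ((C * |x|) ^ k / k.factorial) := by
  induction k generalizing x with
  | zero => simp [dysonTerm]
  | succ k ih =>
    have hC0 : 0 ≤ C := (norm_nonneg _).trans (hC x hx)
    have hb : ∀ t ∈ Set.uIoc 0 x, ‖A t * dysonTerm A k t‖ ≤
        C * (‖(1 : 𝔸)‖ * (C ^ k / k.factorial)) * |t - 0| ^ k := by
      intro t ht
      have : |t| ≤ |x| := by
        rcases Set.mem_uIoc.1 ht with h | h
        · rw [abs_of_pos h.1, abs_of_pos (h.1.trans_le h.2)]; exact h.2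
        · rw [abs_of_nonpos h.2, abs_of_neg (h.1.trans_le h.2)]; linarith
      refine (norm_mul_le _ _).trans ((mul_le_mul (hC t (this.trans hx)) (ih t (this.trans hx))
        (norm_nonneg _) hC0).trans_eq ?_)
      rw [mul_pow, sub_zero]
      ring
    refine (intervalIntegral.norm_integral_le_integral_norm_uIoc).trans ?_
    refine (setIntegral_mono_on ?_ ?_ measurableSet_uIoc hb).trans_eq ?_
    · exact (intervalIntegrable_iff.1
        ((hA.mul (continuous_dysonTerm hA k)).intervalIntegrable 0 x)).norm
    · refine intervalIntegrable_iff.1 (Continuous.intervalIntegrable ?_ 0 x)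
      fun_prop
    · rw [integral_const_mul, integral_pow_abs_sub_uIoc, Nat.factorial_succ, sub_zero, mul_pow]
      push_cast
      have : (k.factorial : ℝ) ≠ 0 := by positivity
      field_simp
      ring

/-- The factorial bound on the Dyson terms is uniform on bounded intervals, so the series may be
differentiated term by term; differentiation shifts the index by one and produces the factor `A x`.
-/
theorem exists_hasDerivAt_eq_mul [CompleteSpace 𝔸] {A : ℝ → 𝔸} (hA : Continuous A) :
    ∃ U : ℝ → 𝔸, U 0 = 1 ∧ ∀ x, HasDerivAt U (A x * U x) x := by
  have hbd : ∀ T : ℝ, ∃ C, ∀ x, |x| ≤ T → ‖A x‖ ≤ C := by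
    intro T
    obtain ⟨C, hC⟩ := (isCompact_Icc (a := -T) (b := T)).exists_bound_of_continuousOn
      hA.continuousOn
    exact ⟨C, fun x hx => hC x (abs_le.1 hx)⟩
  have hsum : ∀ x, Summable fun k => dysonTerm A k x := by
    intro x
    obtain ⟨C, hC⟩ := hbd |x|
    exact .of_norm_bounded ((Real.summable_pow_div_factorial (C * |x|)).mul_left _)
      fun k => norm_dysonTerm_le hA hC k x le_rfl
  refine ⟨fun x => ∑' k, dysonTerm A k x, ?_, fun x => ?_⟩
  · change ∑' k, dysonTerm A k 0 = 1
    rw [tsum_eq_single 0]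
    · rfl
    · intro k hk
      obtain ⟨k, rfl⟩ := Nat.exists_eq_succ_of_ne_zero hk
      simp [dysonTerm]
  · obtain ⟨C, hC⟩ := hbd (|x| + 1)
    have hC0 : 0 ≤ C := (norm_nonneg _).trans (hC x (by linarith))
    have hd := hasDerivAt_tsum_of_isPreconnected
      (g := fun k => dysonTerm A (k + 1)) (g' := fun k y => A y * dysonTerm A k y)
      (u := fun k : ℕ => C * (‖(1 : 𝔸)‖ * ((C * (|x| + 1)) ^ k / k.factorial)))
      (t := Metric.ball 0 (|x| + 1)) (y₀ := 0) (y := x)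
      (((Real.summable_pow_div_factorial _).mul_left _).mul_left _)
      Metric.isOpen_ball (convex_ball _ _).isPreconnected
      (fun k y _ => hasDerivAt_dysonTerm_succ hA k y) ?_
      (by simp; positivity) ((summable_nat_add_iff 1).2 (hsum 0)) (by simp)
    · rw [(hsum x).tsum_mul_left] at hd
      have e : (fun y => ∑' k, dysonTerm A k y) = fun y => 1 + ∑' k, dysonTerm A (k + 1) y := by
        funext y
        rw [(hsum y).tsum_eq_zero_add]
        rfl
      simp only [e]
      exact hd.const_add 1
    · intro k y hy
      have hy' : |y| ≤ |x| + 1 := by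
        have := Metric.mem_ball.1 hy
        rw [dist_zero_right, Real.norm_eq_abs] at this
        exact this.le
      refine (norm_mul_le _ _).trans (mul_le_mul (hC y hy')
        ((norm_dysonTerm_le hA hC k y hy').trans ?_) (norm_nonneg _) hC0)
      gcongr

end LinearODE

/-! ### The operator identity and positivity of `S(x)` -/

namespace SkewDirac

open Complex

theorem signature_conjTranspose (m₁ m₂ : ℕ) : (signature m₁ m₂)ᴴ = signature m₁ m₂ := by
  simp [signature, Matrix.fromBlocks_conjTranspose]

namespace Quadruple

variable {n m₁ m₂ : ℕ} (Q : Quadruple n m₁ m₂)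

/-- The group `e^{itα}`. -/
def flow (t : ℝ) : Matrix (Fin n) (Fin n) ℂ := NormedSpace.exp ((I * (t : ℂ)) • Q.α)

theorem flow_zero : Q.flow 0 = 1 := by simp [flow]

theorem flow_add (s t : ℝ) : Q.flow (s + t) = Q.flow s * Q.flow t := by
  rw [flow, flow, flow, exp_smul_mul_exp_smul]
  push_cast
  rw [mul_add]

theorem flow_mul_flow_neg (t : ℝ) : Q.flow t * Q.flow (-t) = 1 := by
  rw [← flow_add, add_neg_cancel, flow_zero]

theorem flow_neg_mul_flow (t : ℝ) : Q.flow (-t) * Q.flow t = 1 := by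
  rw [← flow_add, neg_add_cancel, flow_zero]

theorem commute_α_flow (t : ℝ) : Commute Q.α (Q.flow t) :=
  ((Commute.refl Q.α).smul_right _).exp_right

theorem conjTranspose_flow (t : ℝ) :
    (Q.flow t)ᴴ = NormedSpace.exp ((-(I * (t : ℂ))) • Q.αᴴ) := by
  rw [flow, exp_smul_conjTranspose]
  simp

theorem hasDerivAt_flow_mul (k x : ℝ) :
    HasDerivAt (fun t => Q.flow (k * t)) ((I * (k : ℂ)) • (Q.α * Q.flow (k * x))) x := by
  have h := hasDerivAt_exp_mul_smul (I * (k : ℂ)) Q.α x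
  simpa only [flow, ofReal_mul, mul_assoc] using h

theorem hasDerivAt_flow (x : ℝ) : HasDerivAt Q.flow (I • (Q.α * Q.flow x)) x := by
  simpa using Q.hasDerivAt_flow_mul 1 x

theorem continuous_flow : Continuous Q.flow :=
  continuous_iff_continuousAt.2 fun x => (Q.hasDerivAt_flow x).continuousAt

theorem Lam_eq (x : ℝ) : Q.Lam x = Matrix.fromCols (Q.flow (-x) * Q.ϑ₁) (Q.flow x * Q.ϑ₂) := by
  simp [Lam, flow]

theorem Lam_zero : Q.Lam 0 = Matrix.fromCols Q.ϑ₁ Q.ϑ₂ := by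
  simp [Lam_eq, flow_zero]

theorem hasDerivAt_Lam (x : ℝ) :
    HasDerivAt Q.Lam (-(I • (Q.α * Q.Lam x * signature m₁ m₂))) x := by
  have h1 := (Q.hasDerivAt_flow_mul (-1) x).matrix_mul (hasDerivAt_const x Q.ϑ₁)
  have h2 := (Q.hasDerivAt_flow x).matrix_mul (hasDerivAt_const x Q.ϑ₂)
  rw [← hasDerivWithinAt_univ] at h1 h2 ⊢
  have h := h1.matrix_fromCols h2
  simp only [neg_one_mul, ← Lam_eq] at h
  refine h.congr_deriv (Eq.symm ?_)
  rw [Lam_eq, signature, Matrix.mul_fromCols, Matrix.fromCols_mul_fromBlocks]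
  ext i (j | j) <;> simp [Matrix.mul_assoc]

theorem Lam_mul_conjTranspose (x : ℝ) : Q.Lam x * (Q.Lam x)ᴴ =
    (Q.flow (-x) * Q.ϑ₁) * (Q.flow (-x) * Q.ϑ₁)ᴴ + (Q.flow x * Q.ϑ₂) * (Q.flow x * Q.ϑ₂)ᴴ := by
  rw [Lam_eq, Matrix.conjTranspose_fromCols_eq_fromRows_conjTranspose,
    Matrix.fromCols_mul_fromRows]

theorem Lam_mul_signature_mul_conjTranspose (x : ℝ) :
    Q.Lam x * signature m₁ m₂ * (Q.Lam x)ᴴ =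
    (Q.flow (-x) * Q.ϑ₁) * (Q.flow (-x) * Q.ϑ₁)ᴴ - (Q.flow x * Q.ϑ₂) * (Q.flow x * Q.ϑ₂)ᴴ := by
  rw [Lam_eq, Matrix.conjTranspose_fromCols_eq_fromRows_conjTranspose, signature,
    Matrix.fromCols_mul_fromBlocks, Matrix.fromCols_mul_fromRows]
  simp [sub_eq_add_neg]

theorem continuous_Lam : Continuous Q.Lam :=
  continuous_iff_continuousAt.2 fun x => (Q.hasDerivAt_Lam x).continuousAt

theorem S_zero : Q.S 0 = Q.S₀ := by simp [S]

theorem hasDerivAt_S (x : ℝ) :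
    HasDerivAt Q.S (Q.Lam x * signature m₁ m₂ * (Q.Lam x)ᴴ) x := by
  have hc : Continuous fun t => Q.Lam t * signature m₁ m₂ * (Q.Lam t)ᴴ :=
    (Q.continuous_Lam.matrix_mul continuous_const).matrix_mul
      Q.continuous_Lam.matrix_conjTranspose
  exact (intervalIntegral.integral_hasDerivAt_right (hc.intervalIntegrable _ _)
    hc.aestronglyMeasurable.stronglyMeasurableAtFilter hc.continuousAt).const_add Q.S₀

variable {Q}

/-- The difference of the two sides has zero derivative, since `Λ' = -i α Λ j` and `S' = Λ j Λ*`,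
and at `x = 0` it vanishes by admissibility. -/
theorem IsAdmissible.identity_S (hQ : Q.IsAdmissible) (x : ℝ) :
    Q.α * Q.S x - Q.S x * Q.αᴴ = I • (Q.Lam x * (Q.Lam x)ᴴ) := by
  have hd : ∀ x, HasDerivAt
      (fun x => Q.α * Q.S x - Q.S x * Q.αᴴ - I • (Q.Lam x * (Q.Lam x)ᴴ)) 0 x := by
    intro x
    have h := (((hasDerivAt_const x Q.α).matrix_mul (Q.hasDerivAt_S x)).sub
      ((Q.hasDerivAt_S x).matrix_mul (hasDerivAt_const x Q.αᴴ))).sub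
      (((Q.hasDerivAt_Lam x).matrix_mul (Q.hasDerivAt_Lam x).matrix_conjTranspose).const_smul I)
    refine h.congr_deriv (Eq.symm ?_)
    simp only [Matrix.conjTranspose_neg, Matrix.conjTranspose_smul, Matrix.conjTranspose_mul,
      signature_conjTranspose, Matrix.neg_mul, Matrix.mul_neg, Matrix.smul_mul, Matrix.mul_smul,
      Matrix.mul_assoc, Matrix.zero_mul, Matrix.mul_zero, star_def, conj_I]
    match_scalars <;> simp
  have hc := is_const_of_deriv_eq_zero (fun x => (hd x).differentiableAt)
    (fun x => (hd x).deriv) x 0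
  simp only [S_zero, Lam_zero, Matrix.conjTranspose_fromCols_eq_fromRows_conjTranspose,
    Matrix.fromCols_mul_fromRows, hQ.identity, sub_self] at hc
  exact sub_eq_zero.1 hc

variable (Q) in
/-- The controllability Gramian `∫₀ˣ e^{2isα} ϑ₁ ϑ₁* e^{-2isα*} ds` of the pair `(α, ϑ₁)`. -/
def gramian (x : ℝ) : Matrix (Fin n) (Fin n) ℂ :=
  ∫ s in (0 : ℝ)..x, (Q.flow (2 * s) * Q.ϑ₁) * (Q.flow (2 * s) * Q.ϑ₁)ᴴ

variable (Q) in
theorem continuous_gramian_integrand :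
    Continuous fun s : ℝ => (Q.flow (2 * s) * Q.ϑ₁) * (Q.flow (2 * s) * Q.ϑ₁)ᴴ := by
  have h : Continuous fun s : ℝ => Q.flow (2 * s) * Q.ϑ₁ :=
    (Q.continuous_flow.comp (continuous_const.mul continuous_id)).matrix_mul continuous_const
  exact h.matrix_mul h.matrix_conjTranspose

variable (Q) in
theorem hasDerivAt_gramian (x : ℝ) :
    HasDerivAt Q.gramian ((Q.flow (2 * x) * Q.ϑ₁) * (Q.flow (2 * x) * Q.ϑ₁)ᴴ) x := by
  have hc := Q.continuous_gramian_integrand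
  exact intervalIntegral.integral_hasDerivAt_right (hc.intervalIntegrable _ _)
    hc.aestronglyMeasurable.stronglyMeasurableAtFilter hc.continuousAt

/-- By the identities for `S(x)` and `S₀`, both sides have derivative `-2 e^{2ixα} ϑ₂ ϑ₂*
e^{-2ixα*}`. The right side is visibly positive and its Gramian grows with `x`; this yields both
`S(x) > 0` and the later decay estimate. -/
theorem IsAdmissible.flow_mul_S_mul_flow (hQ : Q.IsAdmissible) (x : ℝ) :
    Q.flow x * Q.S x * (Q.flow x)ᴴ =
      Q.flow (2 * x) * Q.S₀ * (Q.flow (2 * x))ᴴ + (2 : ℂ) • Q.gramian x := by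
  have hd : ∀ x, HasDerivAt (fun x => Q.flow x * Q.S x * (Q.flow x)ᴴ -
      (Q.flow (2 * x) * Q.S₀ * (Q.flow (2 * x))ᴴ + (2 : ℂ) • Q.gramian x)) 0 x := by
    intro x
    have hf := Q.hasDerivAt_flow x
    have hf2 := Q.hasDerivAt_flow_mul 2 x
    have h := ((hf.matrix_mul (Q.hasDerivAt_S x)).matrix_mul hf.matrix_conjTranspose).sub
      (((hf2.matrix_mul (hasDerivAt_const x Q.S₀)).matrix_mul hf2.matrix_conjTranspose).add
        ((Q.hasDerivAt_gramian x).const_smul (2 : ℂ)))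
    refine h.congr_deriv (Eq.symm ?_)
    have e1 : Q.flow x * (Q.α * Q.S x - Q.S x * Q.αᴴ) * (Q.flow x)ᴴ =
      Q.flow x * (I • (Q.Lam x * (Q.Lam x)ᴴ)) * (Q.flow x)ᴴ := by rw [hQ.identity_S]
    have e2 : Q.flow (2 * x) * (Q.α * Q.S₀ - Q.S₀ * Q.αᴴ) * (Q.flow (2 * x))ᴴ =
      Q.flow (2 * x) * (I • (Q.ϑ₁ * Q.ϑ₁ᴴ + Q.ϑ₂ * Q.ϑ₂ᴴ)) * (Q.flow (2 * x))ᴴ := by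
        rw [hQ.identity]
    have e3 : Q.flow x * Q.flow x = Q.flow (2 * x) := by rw [← flow_add, two_mul]
    have e4 : (Q.flow x)ᴴ * (Q.flow x)ᴴ = (Q.flow (2 * x))ᴴ := by
      rw [← Matrix.conjTranspose_mul, e3]
    have e5 : (Q.flow (-x))ᴴ * (Q.flow x)ᴴ = 1 := by
      rw [← Matrix.conjTranspose_mul, flow_mul_flow_neg, Matrix.conjTranspose_one]
    rw [Lam_mul_conjTranspose] at e1
    rw [Lam_mul_signature_mul_conjTranspose, (Q.commute_α_flow x).eq,
      (Q.commute_α_flow (2 * x)).eq]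
    simp only [Matrix.conjTranspose_smul, Matrix.conjTranspose_mul,
      Matrix.smul_mul, Matrix.mul_smul, Matrix.mul_add,
      Matrix.add_mul, Matrix.mul_sub, Matrix.sub_mul, Matrix.zero_mul, Matrix.mul_zero,
      star_def, conj_I, map_mul, conj_ofReal, smul_add, ← Matrix.mul_assoc, e3,
      flow_mul_flow_neg, Matrix.one_mul] at e1 e2 ⊢
    simp only [Matrix.mul_assoc, e4, e5, Matrix.mul_one, ofReal_ofNat] at e1 e2 ⊢
    linear_combination (norm := (match_scalars <;> ring_nf <;> simp))
      (-I) • e1 + (2 * I) • e2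
  have hc := is_const_of_deriv_eq_zero (fun x => (hd x).differentiableAt)
    (fun x => (hd x).deriv) x 0
  simp only [S_zero, mul_zero, flow_zero, gramian, intervalIntegral.integral_same] at hc
  simp only [Matrix.one_mul, Matrix.conjTranspose_one, Matrix.mul_one, smul_zero, add_zero,
    sub_self] at hc
  exact sub_eq_zero.1 hc

theorem star_dotProduct_gramian (x : ℝ) (k : Fin n → ℂ) :
    star k ⬝ᵥ (Q.gramian x *ᵥ k) = ((∫ s in (0 : ℝ)..x,
      ‖WithLp.toLp 2 ((Q.flow (2 * s) * Q.ϑ₁)ᴴ *ᵥ k)‖ ^ 2 : ℝ) : ℂ) := by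
  let F : Matrix (Fin n) (Fin n) ℂ →L[ℝ] ℂ := LinearMap.toContinuousLinearMap
    { toFun := fun A => star k ⬝ᵥ (A *ᵥ k)
      map_add' := fun A B => by rw [Matrix.add_mulVec, dotProduct_add]
      map_smul' := fun c A => by
        simp [Matrix.smul_mulVec, dotProduct_smul] }
  have h := F.intervalIntegral_comp_comm
    (Q.continuous_gramian_integrand.intervalIntegrable (μ := MeasureTheory.volume) 0 x)
  refine h.symm.trans ?_
  rw [← intervalIntegral.integral_ofReal]
  refine intervalIntegral.integral_congr fun s _ => ?_
  change star k ⬝ᵥ (((Q.flow (2 * s) * Q.ϑ₁) * (Q.flow (2 * s) * Q.ϑ₁)ᴴ) *ᵥ k) = _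
  rw [← Matrix.mulVec_mulVec, Matrix.dotProduct_mulVec, ← Matrix.conjTranspose_conjTranspose
    (Q.flow (2 * s) * Q.ϑ₁), ← Matrix.star_mulVec, Matrix.conjTranspose_conjTranspose]
  rw [EuclideanSpace.norm_sq_eq]
  simp [dotProduct, Complex.conj_mul']

theorem isHermitian_gramian (x : ℝ) : (Q.gramian x).IsHermitian := by
  let F : Matrix (Fin n) (Fin n) ℂ →L[ℝ] Matrix (Fin n) (Fin n) ℂ :=
    LinearMap.toContinuousLinearMap
    { toFun := fun A => Aᴴ
      map_add' := fun A B => Matrix.conjTranspose_add A B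
      map_smul' := fun c A => by
        ext i j
        simp }
  have h := F.intervalIntegral_comp_comm
    (Q.continuous_gramian_integrand.intervalIntegrable (μ := MeasureTheory.volume) 0 x)
  refine h.symm.trans (intervalIntegral.integral_congr fun s _ => ?_)
  exact (Matrix.isHermitian_mul_conjTranspose_self (Q.flow (2 * s) * Q.ϑ₁)).eq

theorem posSemidef_gramian {x : ℝ} (hx : 0 ≤ x) : (Q.gramian x).PosSemidef := by
  refine .of_dotProduct_mulVec_nonneg (isHermitian_gramian x) fun k => ?_
  rw [star_dotProduct_gramian]
  exact_mod_cast intervalIntegral.integral_nonneg hx fun _ _ => by positivity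

theorem star_dotProduct_gramian_mono {x y : ℝ} (hx : 0 ≤ x) (hxy : x ≤ y) (k : Fin n → ℂ) :
    star k ⬝ᵥ (Q.gramian x *ᵥ k) ≤ star k ⬝ᵥ (Q.gramian y *ᵥ k) := by
  rw [star_dotProduct_gramian, star_dotProduct_gramian]
  norm_cast
  have hc : Continuous fun s : ℝ => ‖WithLp.toLp 2 ((Q.flow (2 * s) * Q.ϑ₁)ᴴ *ᵥ k)‖ ^ 2 := by
    have h : Continuous fun s : ℝ => Q.flow (2 * s) * Q.ϑ₁ :=
      (Q.continuous_flow.comp (continuous_const.mul continuous_id)).matrix_mul continuous_const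
    have h2 := h.matrix_conjTranspose.matrix_mulVec (continuous_const (y := k))
    exact ((PiLp.continuous_toLp 2 _).comp h2).norm.pow 2
  exact intervalIntegral.integral_mono_interval le_rfl hx hxy
    (Filter.Eventually.of_forall fun _ => by positivity) (hc.intervalIntegrable _ _)

theorem isUnit_flow (x : ℝ) : IsUnit (Q.flow x) :=
  ⟨⟨Q.flow x, Q.flow (-x), Q.flow_mul_flow_neg x, Q.flow_neg_mul_flow x⟩, rfl⟩

theorem IsAdmissible.posDef_S (hQ : Q.IsAdmissible) {x : ℝ} (hx : 0 ≤ x) : (Q.S x).PosDef := by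
  have h : (Q.flow x * Q.S x * (Q.flow x)ᴴ).PosDef := by
    rw [hQ.flow_mul_S_mul_flow]
    refine Matrix.PosDef.add_posSemidef ?_ ((posSemidef_gramian hx).smul (by norm_num))
    exact (Matrix.IsUnit.posDef_star_right_conjugate_iff (isUnit_flow (2 * x))).2 hQ.posDef
  exact (Matrix.IsUnit.posDef_star_right_conjugate_iff (isUnit_flow x)).1 h

end Quadruple
end SkewDirac

/-! ### Boundedness of the potential and decay in the metric of `S(x)⁻¹` -/

theorem Matrix.PosSemidef.norm_dotProduct_mulVec_sq_le {n : Type*} [Fintype n] [DecidableEq n]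
    {A : Matrix n n ℂ} (hA : A.PosSemidef) (x y : n → ℂ) :
    ‖star x ⬝ᵥ (A *ᵥ y)‖ ^ 2 ≤ (star x ⬝ᵥ (A *ᵥ x)).re * (star y ⬝ᵥ (A *ᵥ y)).re := by
  obtain ⟨B, rfl⟩ : ∃ B : Matrix n n ℂ, A = Bᴴ * B := by
    open scoped MatrixOrder in
    exact CStarAlgebra.nonneg_iff_eq_star_mul_self.1 hA.nonneg
  have e : ∀ u w : n → ℂ, star u ⬝ᵥ ((Bᴴ * B) *ᵥ w) =
      inner ℂ (WithLp.toLp 2 (B *ᵥ u)) (WithLp.toLp 2 (B *ᵥ w)) := by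
    intro u w
    rw [← Matrix.mulVec_mulVec, Matrix.dotProduct_mulVec, ← Matrix.star_mulVec,
      EuclideanSpace.inner_toLp_toLp, dotProduct_comm]
  rw [e, e, e, sq]
  calc _ ≤ (‖WithLp.toLp 2 (B *ᵥ x)‖ * ‖WithLp.toLp 2 (B *ᵥ y)‖) *
        (‖WithLp.toLp 2 (B *ᵥ x)‖ * ‖WithLp.toLp 2 (B *ᵥ y)‖) := by
        gcongr <;> exact norm_inner_le_norm _ _
    _ = _ := by
      have h := fun u : n → ℂ => inner_self_eq_norm_sq (𝕜 := ℂ) (WithLp.toLp 2 (B *ᵥ u))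
      simp only [RCLike.re_to_complex] at h
      rw [h, h]
      ring

namespace SkewDirac

open Complex

namespace Quadruple

variable {n m₁ m₂ : ℕ} {Q : Quadruple n m₁ m₂}

variable (Q) in
/-- The matrix `Λ(x)* S(x)⁻¹ Λ(x)`, whose upper right block is half of the potential. -/
def weight (x : ℝ) : Matrix (Fin m₁ ⊕ Fin m₂) (Fin m₁ ⊕ Fin m₂) ℂ :=
  (Q.Lam x)ᴴ * (Q.S x)⁻¹ * Q.Lam x

theorem weight_eq_fromBlocks (x : ℝ) : Q.weight x = Matrix.fromBlocks
    ((Q.flow (-x) * Q.ϑ₁)ᴴ * (Q.S x)⁻¹ * (Q.flow (-x) * Q.ϑ₁))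
    ((Q.flow (-x) * Q.ϑ₁)ᴴ * (Q.S x)⁻¹ * (Q.flow x * Q.ϑ₂))
    ((Q.flow x * Q.ϑ₂)ᴴ * (Q.S x)⁻¹ * (Q.flow (-x) * Q.ϑ₁))
    ((Q.flow x * Q.ϑ₂)ᴴ * (Q.S x)⁻¹ * (Q.flow x * Q.ϑ₂)) := by
  rw [weight, Lam_eq, Matrix.conjTranspose_fromCols_eq_fromRows_conjTranspose,
    Matrix.fromRows_mul, Matrix.fromRows_mul_fromCols]

theorem potential_eq (x : ℝ) : Q.potential x =
    (2 : ℂ) • ((Q.flow (-x) * Q.ϑ₁)ᴴ * (Q.S x)⁻¹ * (Q.flow x * Q.ϑ₂)) := by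
  rw [potential, Matrix.conjTranspose_mul, conjTranspose_flow, flow]
  simp only [Matrix.mul_assoc, ofReal_neg, mul_neg, neg_neg]

theorem IsAdmissible.posSemidef_weight (hQ : Q.IsAdmissible) {x : ℝ} (hx : 0 ≤ x) :
    (Q.weight x).PosSemidef :=
  (hQ.posDef_S hx).inv.posSemidef.conjTranspose_mul_mul_same _

theorem IsAdmissible.isUnit_S (hQ : Q.IsAdmissible) {x : ℝ} (hx : 0 ≤ x) : IsUnit (Q.S x) :=
  (hQ.posDef_S hx).isUnit

theorem IsAdmissible.S_mul_inv (hQ : Q.IsAdmissible) {x : ℝ} (hx : 0 ≤ x) :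
    Q.S x * (Q.S x)⁻¹ = 1 :=
  Matrix.mul_nonsing_inv _ ((Matrix.isUnit_iff_isUnit_det _).1 (hQ.isUnit_S hx))

theorem IsAdmissible.inv_mul_S (hQ : Q.IsAdmissible) {x : ℝ} (hx : 0 ≤ x) :
    (Q.S x)⁻¹ * Q.S x = 1 :=
  Matrix.nonsing_inv_mul _ ((Matrix.isUnit_iff_isUnit_det _).1 (hQ.isUnit_S hx))

/-- By cyclicity the trace is that of `S⁻¹ Λ Λ*`, and `i S⁻¹ Λ Λ* = S⁻¹ α S - α*`. The value does
not depend on `x`, which is what bounds `v`. -/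
theorem IsAdmissible.trace_weight (hQ : Q.IsAdmissible) {x : ℝ} (hx : 0 ≤ x) :
    (Q.weight x).trace = -I * (Q.α.trace - Q.αᴴ.trace) := by
  have h := congrArg (fun A => (A * (Q.S x)⁻¹).trace) (hQ.identity_S x)
  simp only [Matrix.sub_mul, Matrix.trace_sub, Matrix.smul_mul, Matrix.trace_smul,
    smul_eq_mul] at h
  rw [Matrix.mul_assoc, hQ.S_mul_inv hx, Matrix.mul_one, Matrix.trace_mul_cycle,
    hQ.inv_mul_S hx, Matrix.one_mul] at h
  rw [weight, Matrix.trace_mul_cycle, h, ← mul_assoc]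
  simp

/-- The commutator with `j` kills the diagonal blocks and doubles the off-diagonal ones up to sign.
In this form `j V` can be compared directly with the derivative of `Λ* S⁻¹`. -/
theorem IsAdmissible.signature_mul_offDiag (hQ : Q.IsAdmissible) {x : ℝ} (hx : 0 ≤ x) :
    signature m₁ m₂ * offDiag (Q.potential x) =
      signature m₁ m₂ * Q.weight x - Q.weight x * signature m₁ m₂ := by
  have hS : ((Q.S x)⁻¹)ᴴ = (Q.S x)⁻¹ := (hQ.posDef_S hx).isHermitian.inv.eq
  rw [weight_eq_fromBlocks, signature, offDiag, potential_eq, Matrix.fromBlocks_multiply,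
    Matrix.fromBlocks_multiply, Matrix.fromBlocks_multiply, sub_eq_add_neg,
    Matrix.fromBlocks_neg, Matrix.fromBlocks_add]
  congr 1
  · simp
  · simp [two_smul]
  · simp [two_smul, Matrix.mul_assoc, hS]
  · simp

theorem IsAdmissible.exists_isBoundedBy (hQ : Q.IsAdmissible) :
    ∃ M : ℝ, 0 < M ∧ IsBoundedBy Q.potential M := by
  set K : ℝ := (-I * (Q.α.trace - Q.αᴴ.trace)).re with hK
  have hdiag : ∀ x, 0 ≤ x → ∀ i, 0 ≤ (Q.weight x i i).re ∧ (Q.weight x i i).re ≤ K := by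
    intro x hx i
    have h0 : ∀ i, 0 ≤ (Q.weight x i i).re := fun i =>
      (Complex.le_def.1 ((hQ.posSemidef_weight hx).diag_nonneg (i := i))).1
    refine ⟨h0 i, ?_⟩
    rw [hK, ← hQ.trace_weight hx, Matrix.trace, Complex.re_sum]
    exact Finset.single_le_sum (f := fun i => (Q.weight x i i).re) (fun i _ => h0 i)
      (Finset.mem_univ i)
  -- Cauchy–Schwarz for the semidefinite weight bounds each entry by the diagonal ones, which lie
  -- between `0` and the constant trace.
  have hent : ∀ x, 0 ≤ x → ∀ i j, ‖Q.weight x i j‖ ≤ |K| := by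
    intro x hx i j
    have h := (hQ.posSemidef_weight hx).norm_dotProduct_mulVec_sq_le (Pi.single i 1)
      (Pi.single j 1)
    simp only [Matrix.mulVec_single_one, Pi.star_single, star_one, single_dotProduct, one_mul,
      Matrix.col_apply] at h
    have h2 := mul_le_mul (hdiag x hx i).2 (hdiag x hx j).2 (hdiag x hx j).1
      ((hdiag x hx i).1.trans (hdiag x hx i).2)
    rw [← abs_norm]
    exact sq_le_sq.1 (by nlinarith)
  -- The summand `1` keeps the bound positive when `m₁` or `m₂` is zero.
  refine ⟨(∑ i, ∑ j, 2 * |K| * ‖(Matrix.single i j 1 : Matrix (Fin m₁) (Fin m₂) ℂ)‖) + 1,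
    by positivity, fun x hx => ?_⟩
  refine le_trans ?_ (le_add_of_nonneg_right zero_le_one)
  rw [Matrix.matrix_eq_sum_single (Q.potential x)]
  refine (norm_sum_le _ _).trans (Finset.sum_le_sum fun i _ => (norm_sum_le _ _).trans
    (Finset.sum_le_sum fun j _ => ?_))
  have e : Q.potential x i j = 2 * Q.weight x (Sum.inl i) (Sum.inr j) := by
    rw [weight_eq_fromBlocks, potential_eq]
    simp
  have e2 : Matrix.single i j (Q.potential x i j) =
      Q.potential x i j • (Matrix.single i j 1 : Matrix (Fin m₁) (Fin m₂) ℂ) := by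
    simp [Matrix.smul_single]
  rw [e2, norm_smul, e, norm_mul]
  have := hent x hx (Sum.inl i) (Sum.inr j)
  simp only [Complex.norm_ofNat]
  gcongr

theorem IsAdmissible.continuousOn_potential (hQ : Q.IsAdmissible) :
    ContinuousOn Q.potential (Set.Ici 0) := by
  intro x hx
  have hL := ((Q.hasDerivAt_flow_mul (-1) x).matrix_mul
    (hasDerivAt_const x Q.ϑ₁)).matrix_conjTranspose
  have hR := (Q.hasDerivAt_flow x).matrix_mul (hasDerivAt_const x Q.ϑ₂)
  have h := ((hL.matrix_mul ((Q.hasDerivAt_S x).matrix_inv (hQ.isUnit_S hx))).matrix_mul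
    hR).const_smul (2 : ℂ)
  simp only [neg_one_mul] at h
  have e : Q.potential = (2 : ℂ) • fun x => (Q.flow (-x) * Q.ϑ₁)ᴴ * (Q.S x)⁻¹ * (Q.flow x * Q.ϑ₂) :=
    funext fun x => potential_eq x
  rw [e]
  exact h.continuousAt.continuousWithinAt

/-- Controllability makes the evolution decay in the metric of `S(x)⁻¹`. -/
theorem IsAdmissible.re_dotProduct_inv_S_le (hQ : Q.IsAdmissible) (z : ℂ) (r : Fin n → ℂ)
    {x : ℝ} (hx : 1 ≤ x) (g : Fin n → ℂ)
    (hg : g = exp (I * z * x) • (Q.flow (-x) *ᵥ (Q.gramian 1 *ᵥ r))) :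
    (star g ⬝ᵥ ((Q.S x)⁻¹ *ᵥ g)).re ≤
      Real.exp (-(2 * z.im * x)) * (star r ⬝ᵥ (Q.gramian 1 *ᵥ r)).re := by
  have hx0 : 0 ≤ x := zero_le_one.trans hx
  have hS := (hQ.posDef_S hx0).isHermitian
  set q := (Q.S x)⁻¹ *ᵥ g with hq
  set k := (Q.flow (-x))ᴴ *ᵥ q with hk
  have hgq : g = Q.S x *ᵥ q := by
    rw [hq, Matrix.mulVec_mulVec, hQ.S_mul_inv hx0, Matrix.one_mulVec]
  have hqk : (Q.flow x)ᴴ *ᵥ k = q := by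
    rw [hk, Matrix.mulVec_mulVec, ← Matrix.conjTranspose_mul, flow_neg_mul_flow,
      Matrix.conjTranspose_one, Matrix.one_mulVec]
  have hqk' : star k ᵥ* Q.flow x = star q := by
    conv_rhs => rw [← hqk, Matrix.star_mulVec, Matrix.conjTranspose_conjTranspose]
  have hkq : star k = star q ᵥ* Q.flow (-x) := by
    rw [hk, Matrix.star_mulVec, Matrix.conjTranspose_conjTranspose]
  have h1 : star g ⬝ᵥ q = star q ⬝ᵥ (Q.S x *ᵥ q) := by
    conv_lhs => rw [hgq, Matrix.star_mulVec, hS.eq, ← Matrix.dotProduct_mulVec]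
  have h2 : star q ⬝ᵥ (Q.S x *ᵥ q) =
      star k ⬝ᵥ ((Q.flow x * Q.S x * (Q.flow x)ᴴ) *ᵥ k) := by
    rw [← Matrix.mulVec_mulVec, hqk, ← Matrix.mulVec_mulVec, Matrix.dotProduct_mulVec (star k),
      hqk']
  -- With `q = S⁻¹ g` and `k = e^{ixα*} q`, the form `g* S⁻¹ g = q* S q` is the conjugated form at
  -- `k`. It dominates twice the Gramian over `[0, x]`, hence, as `x ≥ 1`, twice the one over `[0,
  -- 1]`.
  have h3 : 2 * (star k ⬝ᵥ (Q.gramian 1 *ᵥ k)).re ≤ (star g ⬝ᵥ q).re := by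
    rw [h1, h2, hQ.flow_mul_S_mul_flow, Matrix.add_mulVec, dotProduct_add, Matrix.smul_mulVec,
      dotProduct_smul, add_re]
    have a1 := (Complex.le_def.1 ((hQ.posDef.posSemidef.mul_mul_conjTranspose_same
      (Q.flow (2 * x))).dotProduct_mulVec_nonneg k)).1
    have a2 := (Complex.le_def.1 (star_dotProduct_gramian_mono (Q := Q) zero_le_one hx k)).1
    simp only [zero_re] at a1
    simp only [smul_eq_mul, mul_re, re_ofNat, im_ofNat, zero_mul, sub_zero]
    linarith
  have h4 : ‖star q ⬝ᵥ g‖ ^ 2 = Real.exp (-(2 * z.im * x)) *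
      ‖star k ⬝ᵥ (Q.gramian 1 *ᵥ r)‖ ^ 2 := by
    rw [hkq, ← Matrix.dotProduct_mulVec]
    conv_lhs => rw [hg]
    rw [dotProduct_smul, smul_eq_mul, norm_mul, mul_pow, Complex.norm_exp, ← Real.exp_nat_mul]
    congr 2
    simp
    ring
  have h5 := (posSemidef_gramian (Q := Q) zero_le_one).norm_dotProduct_mulVec_sq_le k r
  have h6 : (star g ⬝ᵥ q).re ≤ ‖star q ⬝ᵥ g‖ := by
    rw [h1, ← hgq]
    exact Complex.re_le_norm _
  have h7 : 0 ≤ (star k ⬝ᵥ (Q.gramian 1 *ᵥ k)).re := (Complex.le_def.1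
    ((posSemidef_gramian (Q := Q) zero_le_one).dotProduct_mulVec_nonneg k)).1
  have h8 : 0 ≤ (star r ⬝ᵥ (Q.gramian 1 *ᵥ r)).re := (Complex.le_def.1
    ((posSemidef_gramian (Q := Q) zero_le_one).dotProduct_mulVec_nonneg r)).1
  set H := (star g ⬝ᵥ q).re
  set a := (star k ⬝ᵥ (Q.gramian 1 *ᵥ k)).re
  set b := (star r ⬝ᵥ (Q.gramian 1 *ᵥ r)).re
  set e := Real.exp (-(2 * z.im * x)) with he
  have he0 : 0 < e := Real.exp_pos _
  have hH : 0 ≤ H := by linarith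
  -- From `H² ≤ e a b` and `2 a ≤ H` follows `H² ≤ e b H`, which is incompatible with `H > e b ≥ 0`.
  by_contra hlt
  rw [not_le] at hlt
  have hb : 0 ≤ e * b := by positivity
  have h9 : H ^ 2 ≤ e * (a * b) := by
    calc H ^ 2 ≤ ‖star q ⬝ᵥ g‖ ^ 2 := by gcongr
      _ ≤ _ := by rw [h4]; gcongr
  have h10 : e * (a * b) ≤ e * b * H := by nlinarith [mul_nonneg hb h7]
  nlinarith

/-! ### Explicit solutions of the Dirac system -/

section ExplicitSolution

variable {κ : Type*}

variable (Q) in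
/-- `e^{-ix(α-z)} G`. -/
def evolution (z : ℂ) (G : Matrix (Fin n) κ ℂ) (x : ℝ) : Matrix (Fin n) κ ℂ :=
  exp (I * z * x) • (Q.flow (-x) * G)

/-- `[e^{izx} C; 0]`. -/
def planeWave (m₂ : ℕ) (z : ℂ) (C : Matrix (Fin m₁) κ ℂ) (x : ℝ) :
    Matrix (Fin m₁ ⊕ Fin m₂) κ ℂ :=
  Matrix.fromRows (exp (I * z * x) • C) 0

variable (Q) in
/-- The explicit solution `[e^{izx} C; 0] - i Λ(x)* S(x)⁻¹ e^{-ix(α-z)} G` of the Dirac system,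
for `C` and `G` with `(α - z) G = ϑ₁ C`. -/
def explicitSolution (z : ℂ) (C : Matrix (Fin m₁) κ ℂ) (G : Matrix (Fin n) κ ℂ) (x : ℝ) :
    Matrix (Fin m₁ ⊕ Fin m₂) κ ℂ :=
  planeWave m₂ z C x - I • ((Q.Lam x)ᴴ * ((Q.S x)⁻¹ * Q.evolution z G x))

theorem signature_mul_planeWave (z : ℂ) (C : Matrix (Fin m₁) κ ℂ) (x : ℝ) :
    signature m₁ m₂ * planeWave m₂ z C x = planeWave m₂ z C x := by
  rw [planeWave, signature, Matrix.fromBlocks_mul_fromRows]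
  simp

theorem explicitSolution_zero (z : ℂ) (C : Matrix (Fin m₁) κ ℂ) (G : Matrix (Fin n) κ ℂ) :
    Q.explicitSolution z C G 0 = Matrix.fromRows (C - I • (Q.ϑ₁ᴴ * (Q.S₀⁻¹ * G)))
      (-(I • (Q.ϑ₂ᴴ * (Q.S₀⁻¹ * G)))) := by
  rw [explicitSolution, evolution, planeWave, Lam_zero, S_zero, neg_zero, flow_zero,
    Matrix.conjTranspose_fromCols_eq_fromRows_conjTranspose, Matrix.fromRows_mul]
  ext (i | i) j <;> simp

/-- The relation at `x = 0` is transported along the flow because `α` commutes with `e^{-ixα}`. -/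
theorem mul_evolution_sub {z : ℂ} {C : Matrix (Fin m₁) κ ℂ} {G : Matrix (Fin n) κ ℂ}
    (h : Q.α * G - z • G = Q.ϑ₁ * C) (x : ℝ) :
    Q.α * Q.evolution z G x - z • Q.evolution z G x = Q.Lam x * planeWave m₂ z C x := by
  rw [Lam_eq, planeWave, Matrix.fromCols_mul_fromRows, Matrix.mul_zero, add_zero,
    Matrix.mul_smul, Matrix.mul_assoc, ← h, evolution, Matrix.mul_sub, Matrix.mul_smul,
    ← Matrix.mul_assoc, (Q.commute_α_flow (-x)).eq, Matrix.mul_smul, Matrix.mul_assoc]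
  module

/-- The intertwining relation `α* q = z q + S⁻¹ Λ w - i S⁻¹ Λ Λ* q` for `q = S⁻¹ e^{-ix(α-z)} G`. -/
theorem IsAdmissible.conjTranspose_α_mul (hQ : Q.IsAdmissible) {z : ℂ}
    {C : Matrix (Fin m₁) κ ℂ} {G : Matrix (Fin n) κ ℂ} (h : Q.α * G - z • G = Q.ϑ₁ * C)
    {x : ℝ} (hx : 0 ≤ x) :
    Q.αᴴ * ((Q.S x)⁻¹ * Q.evolution z G x) =
      z • ((Q.S x)⁻¹ * Q.evolution z G x) + (Q.S x)⁻¹ * (Q.Lam x * planeWave m₂ z C x) -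
      I • ((Q.S x)⁻¹ * (Q.Lam x * ((Q.Lam x)ᴴ * ((Q.S x)⁻¹ * Q.evolution z G x)))) := by
  have hm := mul_evolution_sub h x
  have hid := congrArg (fun A => (Q.S x)⁻¹ * A * ((Q.S x)⁻¹ * Q.evolution z G x)) (hQ.identity_S x)
  have e1 : ∀ A : Matrix (Fin n) κ ℂ, Q.S x * ((Q.S x)⁻¹ * A) = A := fun A => by
    rw [← Matrix.mul_assoc, hQ.S_mul_inv hx, Matrix.one_mul]
  have e2 : ∀ A : Matrix (Fin n) κ ℂ, (Q.S x)⁻¹ * (Q.S x * A) = A := fun A => by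
    rw [← Matrix.mul_assoc, hQ.inv_mul_S hx, Matrix.one_mul]
  simp only [Matrix.mul_assoc, Matrix.mul_sub, Matrix.sub_mul, e1, e2, Matrix.mul_smul,
    Matrix.smul_mul] at hid
  rw [← hm, Matrix.mul_sub, Matrix.mul_smul, ← hid]
  module

/-- With `g` the evolution, `q = S⁻¹ g` and `w` the plane wave, the intertwining relation gives `i
q* Λ w + q* Λ Λ* q = i (g* α* q - z g* q)`, while `Λ w = α g - z g` gives `-i w* Λ* q = -i (g* α* q
- z̄ g* q)`. In the sum the terms with `α*` cancel and `2 Im z g* q` remains. -/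
theorem IsAdmissible.conjTranspose_mul_explicitSolution (hQ : Q.IsAdmissible) {z : ℂ}
    {C : Matrix (Fin m₁) κ ℂ} {G : Matrix (Fin n) κ ℂ} (h : Q.α * G - z • G = Q.ϑ₁ * C)
    {x : ℝ} (hx : 0 ≤ x) :
    (Q.explicitSolution z C G x)ᴴ * Q.explicitSolution z C G x =
      ((Real.exp (-(2 * z.im * x)) : ℝ) : ℂ) • (Cᴴ * C) + ((2 * z.im : ℝ) : ℂ) •
        ((Q.evolution z G x)ᴴ * ((Q.S x)⁻¹ * Q.evolution z G x)) := by
  have hS : ((Q.S x)⁻¹)ᴴ = (Q.S x)⁻¹ := (hQ.posDef_S hx).isHermitian.inv.eq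
  have hw : (planeWave m₂ z C x)ᴴ * planeWave m₂ z C x =
      ((Real.exp (-(2 * z.im * x)) : ℝ) : ℂ) • (Cᴴ * C) := by
    rw [planeWave, Matrix.conjTranspose_fromRows_eq_fromCols_conjTranspose,
      Matrix.fromCols_mul_fromRows, Matrix.mul_zero, add_zero, Matrix.conjTranspose_smul,
      Matrix.smul_mul, Matrix.mul_smul, smul_smul, star_def, Complex.conj_mul', Complex.norm_exp]
    congr 1
    norm_cast
    rw [← Real.exp_nat_mul]
    congr 1
    simp
    ring
  have hk := congrArg (fun A => (Q.evolution z G x)ᴴ * A) (hQ.conjTranspose_α_mul h hx)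
  have hm := congrArg (fun A => Aᴴ * ((Q.S x)⁻¹ * Q.evolution z G x)) (mul_evolution_sub h x)
  have hz : ((2 * z.im : ℝ) : ℂ) = -I * (z - star z) := by
    apply Complex.ext
    · simp
      ring
    · simp
  rw [← hw, hz, explicitSolution]
  simp only [Matrix.conjTranspose_sub, Matrix.conjTranspose_smul, Matrix.conjTranspose_mul,
    Matrix.conjTranspose_conjTranspose, hS, Matrix.smul_mul, Matrix.mul_smul, Matrix.mul_add,
    Matrix.mul_sub, Matrix.sub_mul, star_def, conj_I, Matrix.mul_assoc] at hk hm ⊢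
  linear_combination (norm := (match_scalars <;> ring_nf)) I • hm - I • hk

variable [Fintype κ] [DecidableEq κ]

theorem hasDerivAt_exp_mul_ofReal (z : ℂ) (x : ℝ) :
    HasDerivAt (fun t : ℝ => exp (I * z * t)) (I * z * exp (I * z * x)) x := by
  have h := ((hasDerivAt_id (x : ℂ)).const_mul (I * z)).cexp.comp_ofReal
  simpa [mul_comm] using h

theorem hasDerivAt_evolution (z : ℂ) (G : Matrix (Fin n) κ ℂ) (x : ℝ) :
    HasDerivAt (Q.evolution z G)
      (-(I • (Q.α * Q.evolution z G x - z • Q.evolution z G x))) x := by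
  have h := (hasDerivAt_exp_mul_ofReal z x).smul
    ((Q.hasDerivAt_flow_mul (-1) x).matrix_mul (hasDerivAt_const x G))
  simp only [neg_one_mul] at h
  refine h.congr_deriv ?_
  simp only [evolution, Matrix.mul_smul, Matrix.mul_zero, Matrix.smul_mul, Matrix.mul_assoc]
  match_scalars <;> simp <;> ring

theorem hasDerivAt_planeWave (z : ℂ) (C : Matrix (Fin m₁) κ ℂ) (x : ℝ) :
    HasDerivAt (planeWave m₂ z C) ((I * z) • planeWave m₂ z C x) x := by
  have h := ((hasDerivAt_exp_mul_ofReal z x).smul_const C).hasDerivWithinAt (s := Set.univ)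
  have h2 := h.matrix_fromRows
    (hasDerivWithinAt_const x Set.univ (0 : Matrix (Fin m₂) κ ℂ))
  rw [hasDerivWithinAt_univ] at h2
  refine h2.congr_deriv ?_
  rw [planeWave]
  ext (i | i) j <;> simp [mul_assoc]

theorem IsAdmissible.hasDerivAt_explicitSolution (hQ : Q.IsAdmissible) {z : ℂ}
    {C : Matrix (Fin m₁) κ ℂ} {G : Matrix (Fin n) κ ℂ} (h : Q.α * G - z • G = Q.ϑ₁ * C)
    {x : ℝ} (hx : 0 ≤ x) :
    HasDerivAt (Q.explicitSolution z C G)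
      (coefficient Q.potential x z * Q.explicitSolution z C G x) x := by
  have hd := (hasDerivAt_planeWave (m₂ := m₂) z C x).sub
    (((Q.hasDerivAt_Lam x).matrix_conjTranspose.matrix_mul
      (((Q.hasDerivAt_S x).matrix_inv (hQ.isUnit_S hx)).matrix_mul
        (Q.hasDerivAt_evolution z G x))).const_smul I)
  refine hd.congr_deriv ?_
  have hk := congrArg (fun A => signature m₁ m₂ * ((Q.Lam x)ᴴ * A)) (hQ.conjTranspose_α_mul h hx)
  rw [coefficient, hQ.signature_mul_offDiag hx, explicitSolution, mul_evolution_sub h x, weight]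
  simp only [Matrix.conjTranspose_neg, Matrix.conjTranspose_smul, Matrix.conjTranspose_mul,
    Matrix.neg_mul, Matrix.mul_neg, Matrix.smul_mul, Matrix.mul_smul, Matrix.mul_add,
    Matrix.add_mul, Matrix.mul_sub, Matrix.sub_mul, star_def, conj_I, signature_conjTranspose,
    Matrix.mul_assoc, signature_mul_planeWave] at hk ⊢
  linear_combination (norm := (match_scalars <;> ring_nf <;> simp)) hk

end ExplicitSolution

end Quadruple
end SkewDirac

/-! ### Square integrable solutions for `Im z > M` -/

namespace SkewDirac

open Complex MeasureTheory

section SquareIntegrable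

variable {m₁ m₂ : ℕ} {κ : Type*}
  {v : ℝ → Matrix (Fin m₁) (Fin m₂) ℂ} {M : ℝ} {z : ℂ}

theorem coefficient_mul_apply_inl (x : ℝ) (D : Matrix (Fin m₁ ⊕ Fin m₂) κ ℂ) (i : Fin m₁)
    (a : κ) : (coefficient v x z * D) (Sum.inl i) a =
      I * z * D (Sum.inl i) a + (v x *ᵥ fun k => D (Sum.inr k) a) i := by
  simp [coefficient, signature, offDiag, Matrix.fromBlocks_multiply, Matrix.fromBlocks_smul,
    Matrix.fromBlocks_add, Matrix.mul_apply, Fintype.sum_sum_type, Matrix.mulVec, dotProduct,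
    Matrix.one_apply]

theorem coefficient_mul_apply_inr (x : ℝ) (D : Matrix (Fin m₁ ⊕ Fin m₂) κ ℂ) (i : Fin m₂)
    (a : κ) : (coefficient v x z * D) (Sum.inr i) a =
      -(I * z * D (Sum.inr i) a) - ((v x)ᴴ *ᵥ fun k => D (Sum.inl k) a) i := by
  simp [coefficient, signature, offDiag, Matrix.fromBlocks_multiply, Matrix.fromBlocks_smul,
    Matrix.fromBlocks_add, Matrix.mul_apply, Fintype.sum_sum_type, Matrix.mulVec, dotProduct,
    Matrix.one_apply]
  ring

theorem norm_star_dotProduct_mulVec_le (A : Matrix (Fin m₁) (Fin m₂) ℂ) (x : Fin m₁ → ℂ)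
    (y : Fin m₂ → ℂ) : 2 * ‖star x ⬝ᵥ (A *ᵥ y)‖ ≤ ‖A‖ * (∑ i, ‖x i‖ ^ 2 + ∑ i, ‖y i‖ ^ 2) := by
  have e : star x ⬝ᵥ (A *ᵥ y) = inner ℂ (WithLp.toLp 2 x) (WithLp.toLp 2 (A *ᵥ y)) := by
    rw [EuclideanSpace.inner_toLp_toLp, dotProduct_comm]
  have h1 := norm_inner_le_norm (𝕜 := ℂ) (WithLp.toLp 2 x) (WithLp.toLp 2 (A *ᵥ y))
  have h2 := Matrix.l2_opNorm_mulVec A (WithLp.toLp 2 y)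
  have hx := EuclideanSpace.norm_sq_eq (WithLp.toLp 2 x)
  have hy := EuclideanSpace.norm_sq_eq (WithLp.toLp 2 y)
  replace h2 : ‖WithLp.toLp 2 (A *ᵥ y)‖ ≤ ‖A‖ * ‖WithLp.toLp 2 y‖ := h2
  rw [← hx, ← hy, e]
  have h3 := mul_le_mul_of_nonneg_left h2 (norm_nonneg (WithLp.toLp 2 x))
  nlinarith [mul_nonneg (norm_nonneg A)
    (sq_nonneg (‖WithLp.toLp 2 x‖ - ‖WithLp.toLp 2 y‖))]

variable [Fintype κ] [DecidableEq κ]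

/-- For `Im z > M ≥ ‖v‖` a square integrable solution of the Dirac system is determined by
the upper part of its initial value. -/
theorem eq_zero_of_integrableOn (hv : IsBoundedBy v M) (hz : M < z.im)
    {D : ℝ → Matrix (Fin m₁ ⊕ Fin m₂) κ ℂ}
    (hD : ∀ x, 0 ≤ x → HasDerivWithinAt D (coefficient v x z * D x) (Set.Ici 0) x)
    (hint : ∀ i a, IntegrableOn (fun x => ‖D x i a‖ ^ 2) (Set.Ici 0))
    (h0 : ∀ i a, D 0 (Sum.inl i) a = 0) : D 0 = 0 := by
  suffices h : ∀ a, ∑ i, ‖D 0 (Sum.inr i) a‖ ^ 2 = 0 by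
    ext (i | i) a
    · exact h0 i a
    · have := (Finset.sum_eq_zero_iff_of_nonneg (fun _ _ => by positivity)).1 (h a) i
        (Finset.mem_univ i)
      simpa using this
  intro a
  set q : ℝ → ℝ := fun x => ∑ i, ‖D x (Sum.inr i) a‖ ^ 2 - ∑ i, ‖D x (Sum.inl i) a‖ ^ 2 with hq
  have hent : ∀ x, 0 ≤ x → ∀ i, HasDerivWithinAt (fun t => ‖D t i a‖ ^ 2)
      (2 * (star (D x i a) * (coefficient v x z * D x) i a).re) (Set.Ici 0) x := by
    intro x hx i
    have h := (hasDerivWithinAt_matrix.1 (hD x hx) i a).norm_sq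
    refine h.congr_deriv ?_
    rw [Complex.inner, star_def, mul_comm ((starRingEnd ℂ) _)]
  have hqd : ∀ x, 0 ≤ x → HasDerivWithinAt q
      (∑ i, 2 * (star (D x (Sum.inr i) a) * (coefficient v x z * D x) (Sum.inr i) a).re -
        ∑ i, 2 * (star (D x (Sum.inl i) a) * (coefficient v x z * D x) (Sum.inl i) a).re)
      (Set.Ici 0) x := fun x hx =>
    (HasDerivWithinAt.fun_sum fun i _ => hent x hx (Sum.inr i)).sub
      (HasDerivWithinAt.fun_sum fun i _ => hent x hx (Sum.inl i))
  -- The derivative is `2 Im z (|d₁|² + |d₂|²) - 4 Re (d₁* v d₂)`, which is nonnegative because `2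
  -- |d₁* v d₂| ≤ ‖v‖ (|d₁|² + |d₂|²)` and `‖v‖ ≤ M < Im z`.
  have hmono : MonotoneOn q (Set.Ici 0) := by
    refine monotoneOn_of_hasDerivWithinAt_nonneg (convex_Ici 0)
      (fun x hx => (hqd x hx).continuousWithinAt)
      (fun x hx => (hqd x (interior_subset hx)).mono interior_subset) fun x hx => ?_
    have hx0 : 0 ≤ x := interior_subset hx
    set d₁ : Fin m₁ → ℂ := fun i => D x (Sum.inl i) a with hd₁
    set d₂ : Fin m₂ → ℂ := fun i => D x (Sum.inr i) a with hd₂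
    have e1 : ∑ i, 2 * (star (D x (Sum.inl i) a) * (coefficient v x z * D x) (Sum.inl i) a).re =
        -(2 * z.im * ∑ i, ‖d₁ i‖ ^ 2) + 2 * (star d₁ ⬝ᵥ (v x *ᵥ d₂)).re := by
      rw [dotProduct, Complex.re_sum, Finset.mul_sum, Finset.mul_sum, ← Finset.sum_neg_distrib,
        ← Finset.sum_add_distrib]
      refine Finset.sum_congr rfl fun i _ => ?_
      rw [coefficient_mul_apply_inl, mul_add, add_re, mul_add, Complex.sq_norm, normSq_apply]
      simp [hd₁, hd₂]
      ring
    have e2 : ∑ i, 2 * (star (D x (Sum.inr i) a) * (coefficient v x z * D x) (Sum.inr i) a).re =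
        2 * z.im * ∑ i, ‖d₂ i‖ ^ 2 - 2 * (star d₂ ⬝ᵥ ((v x)ᴴ *ᵥ d₁)).re := by
      rw [dotProduct, Complex.re_sum, Finset.mul_sum, Finset.mul_sum,
        ← Finset.sum_sub_distrib]
      refine Finset.sum_congr rfl fun i _ => ?_
      rw [coefficient_mul_apply_inr, mul_sub, sub_re, mul_sub, Complex.sq_norm, normSq_apply]
      simp [hd₁, hd₂]
      ring
    have e3 : (star d₂ ⬝ᵥ ((v x)ᴴ *ᵥ d₁)).re = (star d₁ ⬝ᵥ (v x *ᵥ d₂)).re := by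
      have : star d₂ ⬝ᵥ ((v x)ᴴ *ᵥ d₁) = star (star d₁ ⬝ᵥ (v x *ᵥ d₂)) := by
        rw [Matrix.star_dotProduct, Matrix.star_mulVec, Matrix.conjTranspose_conjTranspose,
          ← Matrix.dotProduct_mulVec]
      rw [this, star_def, conj_re]
    rw [e1, e2, e3]
    have h1 := norm_star_dotProduct_mulVec_le (v x) d₁ d₂
    have h2 := Complex.re_le_norm (star d₁ ⬝ᵥ (v x *ᵥ d₂))
    have h3 : 0 ≤ ∑ i, ‖d₁ i‖ ^ 2 + ∑ i, ‖d₂ i‖ ^ 2 := by positivity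
    have h4 := mul_le_mul_of_nonneg_right ((hv x hx0).trans hz.le) h3
    nlinarith
  have hq0 : q 0 = ∑ i, ‖D 0 (Sum.inr i) a‖ ^ 2 := by simp [hq, h0]
  rw [← hq0]
  have hq0' : 0 ≤ q 0 := by rw [hq0]; positivity
  have hbound : ∀ x ∈ Set.Ici (0 : ℝ), ‖q 0‖ ≤ ∑ i, ‖D x (Sum.inr i) a‖ ^ 2 := by
    intro x hx
    rw [Real.norm_of_nonneg hq0']
    have h1 := hmono Set.self_mem_Ici hx hx
    have h2 : 0 ≤ ∑ i, ‖D x (Sum.inl i) a‖ ^ 2 := by positivity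
    simp only [hq] at h1 ⊢
    linarith
  -- The constant `q 0` is dominated by an integrable function on a set of infinite measure, so it
  -- is zero.
  have hc : IntegrableOn (fun _ : ℝ => q 0) (Set.Ici 0) :=
    Integrable.mono' (integrable_finsetSum _ fun i _ => hint (Sum.inr i) a)
      aestronglyMeasurable_const ((ae_restrict_iff' measurableSet_Ici).2 (.of_forall hbound))
  rw [integrableOn_const_iff] at hc
  simpa using hc

theorem continuousOn_coefficient (hv : ContinuousOn v (Set.Ici 0)) (z : ℂ) :
    ContinuousOn (fun x => coefficient v x z) (Set.Ici 0) := by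
  have h : Continuous (offDiag : Matrix (Fin m₁) (Fin m₂) ℂ → _) :=
    continuous_const.matrix_fromBlocks continuous_id continuous_id.matrix_conjTranspose
      continuous_const
  exact continuousOn_const.add (continuousOn_const.mul (h.comp_continuousOn hv))

theorem eq_zero_of_initial_eq_zero (hv : ContinuousOn v (Set.Ici 0))
    {D : ℝ → Matrix (Fin m₁ ⊕ Fin m₂) κ ℂ}
    (hD : ∀ x, 0 ≤ x → HasDerivWithinAt D (coefficient v x z * D x) (Set.Ici 0) x)
    (h0 : D 0 = 0) {x : ℝ} (hx : 0 ≤ x) : D x = 0 := by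
  obtain ⟨K, hK⟩ := (isCompact_Icc (a := 0) (b := x)).exists_bound_of_continuousOn
    ((continuousOn_coefficient hv z).mono Set.Icc_subset_Ici_self)
  refine eq_zero_of_abs_deriv_le_mul_abs_self_of_eq_zero_right (a := 0) (b := x) (K := K)
    (f' := fun t => coefficient v t z * D t)
    (fun t ht => ((hD t ht.1).continuousWithinAt).mono Set.Icc_subset_Ici_self)
    (fun t ht => (hD t ht.1).mono (Set.Ici_subset_Ici.2 ht.1)) h0 (fun t ht => ?_) x
    ⟨hx, le_rfl⟩
  refine (Matrix.l2_opNorm_mul _ _).trans ?_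
  gcongr
  exact hK t ⟨ht.1, ht.2.le⟩

/-- Translates the matrix integral of the Weyl condition into scalar ones: diagonal entries of `D*
D` are the column sums of `‖D i a‖²`, and off-diagonal entries are controlled by `2 |a b| ≤ |a|² +
|b|²`. -/
theorem integrableOn_conjTranspose_mul_self_iff {D : ℝ → Matrix (Fin m₁ ⊕ Fin m₂) κ ℂ}
    (hD : ContinuousOn D (Set.Ici 0)) :
    IntegrableOn (fun x => (D x)ᴴ * D x) (Set.Ici 0) ↔
      ∀ i a, IntegrableOn (fun x => ‖D x i a‖ ^ 2) (Set.Ici 0) := by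
  have hc : ∀ i a, ContinuousOn (fun x => D x i a) (Set.Ici 0) := fun i a =>
    (continuous_id.matrix_elem i a).comp_continuousOn hD
  constructor
  · intro h i a
    have h2 := (LinearMap.toContinuousLinearMap
      (Matrix.entryLinearMap ℝ ℂ a a : Matrix κ κ ℂ →ₗ[ℝ] ℂ)).integrable_comp h
    refine Integrable.mono' h2.norm
      ((hc i a).norm.pow 2 |>.aestronglyMeasurable measurableSet_Ici) (.of_forall fun x => ?_)
    have e : ((D x)ᴴ * D x) a a = ((∑ i, ‖D x i a‖ ^ 2 : ℝ) : ℂ) := by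
      simp [Matrix.mul_apply, Complex.conj_mul']
    change ‖‖D x i a‖ ^ 2‖ ≤ ‖((D x)ᴴ * D x) a a‖
    rw [e, Complex.norm_real, Real.norm_of_nonneg (by positivity),
      Real.norm_of_nonneg (by positivity)]
    exact Finset.single_le_sum (f := fun i => ‖D x i a‖ ^ 2) (fun i _ => by positivity)
      (Finset.mem_univ i)
  · intro h
    have hab : ∀ a b, IntegrableOn (fun x => ((D x)ᴴ * D x) a b) (Set.Ici 0) := by
      intro a b
      simp only [Matrix.mul_apply]
      refine integrable_finsetSum _ fun i _ => ?_
      refine Integrable.mono' ((h i a).add (h i b))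
        (((hc i a).star.mul (hc i b)).aestronglyMeasurable measurableSet_Ici)
        (.of_forall fun x => ?_)
      rw [Matrix.conjTranspose_apply, norm_mul, norm_star, Pi.add_apply]
      nlinarith [sq_nonneg (‖D x i a‖ - ‖D x i b‖), sq_nonneg (‖D x i a‖ + ‖D x i b‖)]
    have e : (fun x => (D x)ᴴ * D x) =
        fun x => ∑ a, ∑ b, Matrix.single a b (((D x)ᴴ * D x) a b) :=
      funext fun x => Matrix.matrix_eq_sum_single _
    rw [e]
    refine integrable_finsetSum _ fun a _ => integrable_finsetSum _ fun b _ => ?_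
    exact (LinearMap.toContinuousLinearMap
      (Matrix.singleLinearMap ℝ a b : ℂ →ₗ[ℝ] Matrix κ κ ℂ)).integrable_comp (hab a b)

/-- The fundamental solution exists for a potential that is continuous on the half-line. -/
theorem exists_isFundamentalSolution (hv : ContinuousOn v (Set.Ici 0)) :
    ∃ u, IsFundamentalSolution v u := by
  have h : ∀ z : ℂ, ∃ U : ℝ → Matrix (Fin m₁ ⊕ Fin m₂) (Fin m₁ ⊕ Fin m₂) ℂ,
      -- Freezing the potential at its value at `0` for negative `x` makes the coefficient
      -- continuous on the whole line.
      U 0 = 1 ∧ ∀ x, HasDerivAt U (coefficient v (max x 0) z * U x) x := fun z =>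
    exists_hasDerivAt_eq_mul ((continuousOn_coefficient hv z).comp_continuous
      (continuous_id.max continuous_const) fun x => le_max_right x 0)
  choose U hU0 hU using h
  refine ⟨fun x z => U z x, hU0, fun z x hx => ?_⟩
  have := (hU z x).hasDerivWithinAt (s := Set.Ici 0)
  rwa [max_eq_left hx] at this

theorem IsFundamentalSolution.hasDerivWithinAt_mul
    {u : ℝ → ℂ → Matrix (Fin m₁ ⊕ Fin m₂) (Fin m₁ ⊕ Fin m₂) ℂ} (hu : IsFundamentalSolution v u)
    (A : Matrix (Fin m₁ ⊕ Fin m₂) κ ℂ) {x : ℝ} (hx : 0 ≤ x) :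
    HasDerivWithinAt (fun x => u x z * A) (coefficient v x z * (u x z * A)) (Set.Ici 0) x := by
  refine ((hu.deriv z x hx).matrix_mul (hasDerivWithinAt_const x _ A)).congr_deriv ?_
  rw [Matrix.mul_zero, add_zero, Matrix.mul_assoc]

end SquareIntegrable

namespace Quadruple

variable {n m₁ m₂ : ℕ} {Q : Quadruple n m₁ m₂} {κ : Type*} [Fintype κ] [DecidableEq κ]

theorem IsAdmissible.integrableOn_explicitSolution (hQ : Q.IsAdmissible) {z : ℂ} (hz : 0 < z.im)
    {C : Matrix (Fin m₁) κ ℂ} {G R : Matrix (Fin n) κ ℂ} (h : Q.α * G - z • G = Q.ϑ₁ * C)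
    (hG : G = Q.gramian 1 * R) (i : Fin m₁ ⊕ Fin m₂) (a : κ) :
    IntegrableOn (fun x => ‖Q.explicitSolution z C G x i a‖ ^ 2) (Set.Ici 0) := by
  have hc : ContinuousOn (fun x => ‖Q.explicitSolution z C G x i a‖ ^ 2) (Set.Ici 0) := by
    intro x hx
    exact (((continuous_id.matrix_elem i a).continuousAt.comp_continuousWithinAt
      (hQ.hasDerivAt_explicitSolution h hx).continuousAt.continuousWithinAt).norm.pow 2)
  rw [← Set.Icc_union_Ici_eq_Ici zero_le_one, integrableOn_union]
  refine ⟨(hc.mono Set.Icc_subset_Ici_self).integrableOn_Icc, ?_⟩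
  -- `K e^{-2 Im z x}` bounds the diagonal entry of `Y* Y` for `x ≥ 1`, by the norm identity and the
  -- decay estimate; on `[0, 1]` continuity suffices.
  set K : ℝ := ((Cᴴ * C) a a).re + 2 * z.im *
    (star (R.col a) ⬝ᵥ (Q.gramian 1 *ᵥ R.col a)).re with hK
  have hexp : IntegrableOn (fun x => Real.exp (-(2 * z.im) * x) * K) (Set.Ici 1) := by
    rw [integrableOn_Ici_iff_integrableOn_Ioi]
    exact (exp_neg_integrableOn_Ioi 1 (by positivity)).mul_const K
  refine Integrable.mono' hexp ((hc.mono (Set.Ici_subset_Ici.2 zero_le_one)).aestronglyMeasurable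
    measurableSet_Ici) ((ae_restrict_iff' measurableSet_Ici).2 (.of_forall fun x hx => ?_))
  have hx1 : 1 ≤ x := hx
  have hx0 : 0 ≤ x := zero_le_one.trans hx1
  rw [Real.norm_of_nonneg (by positivity)]
  have e := congrArg (fun A => (A a a).re) (hQ.conjTranspose_mul_explicitSolution h hx0)
  have e1 : ∀ A : Matrix (Fin m₁ ⊕ Fin m₂) κ ℂ, (Aᴴ * A) a a = ((∑ i, ‖A i a‖ ^ 2 : ℝ) : ℂ) := by
    intro A
    simp [Matrix.mul_apply, Complex.conj_mul']
  have hle := Finset.single_le_sum (f := fun i => ‖Q.explicitSolution z C G x i a‖ ^ 2)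
    (fun i _ => by positivity) (Finset.mem_univ i)
  simp only [e1, ofReal_re, Matrix.add_apply, Matrix.smul_apply, smul_eq_mul, add_re,
    re_ofReal_mul] at e
  refine hle.trans (e.le.trans ?_)
  have hdec := hQ.re_dotProduct_inv_S_le z (R.col a) hx1 ((Q.evolution z G x).col a) (by
    rw [evolution, hG, Matrix.mulVec_mulVec, ← Matrix.mul_assoc]
    ext k
    simp [Matrix.mul_apply, Matrix.mulVec, dotProduct])
  have e2 : ((Q.evolution z G x)ᴴ * ((Q.S x)⁻¹ * Q.evolution z G x)) a a =
      star ((Q.evolution z G x).col a) ⬝ᵥ ((Q.S x)⁻¹ *ᵥ (Q.evolution z G x).col a) := by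
    simp [Matrix.mul_apply, Matrix.mulVec, dotProduct]
  rw [e2, hK, neg_mul]
  have := mul_le_mul_of_nonneg_left hdec (by positivity : 0 ≤ 2 * z.im)
  linarith

end Quadruple
end SkewDirac

/-! ### The range of the Gramian and construction of decaying solutions -/

/-- The range of a Hermitian matrix is the orthogonal complement of its kernel. Statements about the
range of the Gramian thus reduce to statements about its kernel. -/
theorem Matrix.IsHermitian.mem_range_mulVecLin_iff {n : Type*} [Fintype n] [DecidableEq n]
    {A : Matrix n n ℂ} (hA : A.IsHermitian) (g : n → ℂ) :
    g ∈ LinearMap.range A.mulVecLin ↔ ∀ k, A *ᵥ k = 0 → star k ⬝ᵥ g = 0 := by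
  constructor
  · rintro ⟨r, rfl⟩ k hk
    rw [Matrix.mulVecLin_apply, Matrix.dotProduct_mulVec]
    nth_rw 1 [← hA.eq]
    rw [← Matrix.star_mulVec, hk, star_zero, zero_dotProduct]
  · intro h
    have hs := Matrix.isSymmetric_toEuclideanLin_iff.2 hA
    have hg : WithLp.toLp 2 g ∈ (LinearMap.range A.toEuclideanLin) := by
      rw [← Submodule.orthogonal_orthogonal (LinearMap.range A.toEuclideanLin),
        hs.orthogonal_range, Submodule.mem_orthogonal]
      intro k hk
      rw [LinearMap.mem_ker] at hk
      have hk' : A *ᵥ k.ofLp = 0 := congrArg WithLp.ofLp hk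
      have := h _ hk'
      rw [EuclideanSpace.inner_eq_star_dotProduct, dotProduct_comm]
      exact this
    obtain ⟨r, hr⟩ := hg
    exact ⟨r.ofLp, congrArg WithLp.ofLp hr⟩

namespace SkewDirac

open Complex MeasureTheory

namespace Quadruple

variable {n m₁ m₂ : ℕ} {Q : Quadruple n m₁ m₂}

theorem hasDerivAt_observation (k : Fin n → ℂ) (s : ℝ) :
    HasDerivAt (fun s => (Q.flow (2 * s) * Q.ϑ₁)ᴴ *ᵥ k)
      (-(2 * I) • ((Q.flow (2 * s) * Q.ϑ₁)ᴴ *ᵥ (Q.αᴴ *ᵥ k))) s := by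
  have h := (((Q.hasDerivAt_flow_mul 2 s).matrix_mul
    (hasDerivAt_const s Q.ϑ₁)).matrix_conjTranspose.matrix_mul
      (hasDerivAt_const s (Matrix.replicateCol Unit k))).hasDerivWithinAt (s := Set.univ)
  rw [hasDerivAt_pi]
  intro i
  have h2 := hasDerivWithinAt_matrix.1 h i ()
  rw [hasDerivWithinAt_univ] at h2
  refine h2.congr_deriv ?_
  rw [Matrix.mul_zero, Matrix.mul_zero, add_zero, add_zero, Matrix.mulVec_mulVec]
  simp only [Matrix.conjTranspose_mul, Matrix.conjTranspose_smul, Matrix.mul_assoc,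
    Matrix.smul_mul]
  simp only [Matrix.smul_apply, Pi.smul_apply, ← Matrix.mul_assoc]
  congr 1
  simp
  ring

theorem continuous_observation (k : Fin n → ℂ) :
    Continuous fun s => (Q.flow (2 * s) * Q.ϑ₁)ᴴ *ᵥ k :=
  continuous_iff_continuousAt.2 fun s => (hasDerivAt_observation k s).continuousAt

/-- A semidefinite matrix annihilates `k` exactly when its form vanishes at `k`; here the form is
the integral of a continuous nonnegative function. -/
theorem gramian_mulVec_eq_zero_iff (k : Fin n → ℂ) :
    Q.gramian 1 *ᵥ k = 0 ↔ ∀ s ∈ Set.Icc (0 : ℝ) 1, (Q.flow (2 * s) * Q.ϑ₁)ᴴ *ᵥ k = 0 := by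
  rw [← (posSemidef_gramian (Q := Q) zero_le_one).dotProduct_mulVec_zero_iff,
    star_dotProduct_gramian, ofReal_eq_zero]
  have hc : Continuous fun s : ℝ => ‖WithLp.toLp 2 ((Q.flow (2 * s) * Q.ϑ₁)ᴴ *ᵥ k)‖ ^ 2 :=
    ((PiLp.continuous_toLp 2 _).comp (continuous_observation k)).norm.pow 2
  constructor
  · intro h s hs
    by_contra hne
    have hpos := intervalIntegral.integral_pos zero_lt_one hc.continuousOn
      (fun _ _ => by positivity) ⟨s, hs, by
        have : WithLp.toLp 2 ((Q.flow (2 * s) * Q.ϑ₁)ᴴ *ᵥ k) ≠ 0 := by simpa using hne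
        positivity⟩
    exact hpos.ne' h
  · intro h
    rw [intervalIntegral.integral_congr (g := fun _ => (0 : ℝ)), intervalIntegral.integral_zero]
    intro s hs
    rw [Set.uIcc_of_le zero_le_one] at hs
    simp only [h s hs, WithLp.toLp_zero, norm_zero]
    norm_num

/-- Differentiating `ϑ₁* e^{-2isα*} k = 0` in `s` replaces `k` by `α* k` up to a nonzero scalar.
This works in the open interval, and continuity covers the endpoints. -/
theorem gramian_mulVec_conjTranspose_α (k : Fin n → ℂ) (hk : Q.gramian 1 *ᵥ k = 0) :
    Q.gramian 1 *ᵥ (Q.αᴴ *ᵥ k) = 0 := by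
  rw [gramian_mulVec_eq_zero_iff] at hk ⊢
  have hIoo : ∀ s ∈ Set.Ioo (0 : ℝ) 1, (Q.flow (2 * s) * Q.ϑ₁)ᴴ *ᵥ (Q.αᴴ *ᵥ k) = 0 := by
    intro s hs
    have h1 := hasDerivAt_observation (Q := Q) k s
    have h2 : (fun s => (Q.flow (2 * s) * Q.ϑ₁)ᴴ *ᵥ k) =ᶠ[nhds s] fun _ => 0 := by
      filter_upwards [isOpen_Ioo.mem_nhds hs] with t ht
      exact hk t (Set.Ioo_subset_Icc_self ht)
    have h3 := (h1.congr_of_eventuallyEq h2.symm).unique (hasDerivAt_const s 0)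
    exact (smul_eq_zero.1 h3).resolve_left (by simp)
  have hcl := IsClosed.closure_subset_iff (isClosed_eq
    (continuous_observation (Q := Q) (Q.αᴴ *ᵥ k)) continuous_const) |>.2 hIoo
  rw [closure_Ioo zero_ne_one] at hcl
  exact hcl

theorem α_mulVec_mem_range_gramian {g : Fin n → ℂ}
    (hg : g ∈ LinearMap.range (Q.gramian 1).mulVecLin) :
    Q.α *ᵥ g ∈ LinearMap.range (Q.gramian 1).mulVecLin := by
  rw [(isHermitian_gramian 1).mem_range_mulVecLin_iff] at hg ⊢
  intro k hk
  have := hg _ (gramian_mulVec_conjTranspose_α k hk)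
  rwa [Matrix.star_mulVec, Matrix.conjTranspose_conjTranspose, ← Matrix.dotProduct_mulVec] at this

theorem ϑ₁_mulVec_mem_range_gramian (c : Fin m₁ → ℂ) :
    Q.ϑ₁ *ᵥ c ∈ LinearMap.range (Q.gramian 1).mulVecLin := by
  rw [(isHermitian_gramian 1).mem_range_mulVecLin_iff]
  intro k hk
  have h := (gramian_mulVec_eq_zero_iff k).1 hk 0 ⟨le_rfl, zero_le_one⟩
  rw [mul_zero, flow_zero, Matrix.one_mul] at h
  rw [Matrix.dotProduct_mulVec, ← Matrix.conjTranspose_conjTranspose Q.ϑ₁, ← Matrix.star_mulVec, h,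
    star_zero, zero_dotProduct]

/-- The spectrum of `α*` lies in the closed lower half-plane. -/
theorem IsAdmissible.eq_zero_of_conjTranspose_α_mulVec (hQ : Q.IsAdmissible) {z : ℂ}
    (hz : 0 < z.im) {q : Fin n → ℂ} (hq : Q.αᴴ *ᵥ q = z • q) : q = 0 := by
  by_contra hne
  have h := congrArg (fun A => star q ⬝ᵥ (A *ᵥ q)) hQ.identity
  have h1 : star q ⬝ᵥ ((Q.α * Q.S₀) *ᵥ q) = star z * (star q ⬝ᵥ (Q.S₀ *ᵥ q)) := by
    rw [← Matrix.mulVec_mulVec, Matrix.dotProduct_mulVec,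
      ← Matrix.conjTranspose_conjTranspose Q.α, ← Matrix.star_mulVec, hq, star_smul,
      smul_dotProduct, smul_eq_mul]
  have h2 : star q ⬝ᵥ ((Q.S₀ * Q.αᴴ) *ᵥ q) = z * (star q ⬝ᵥ (Q.S₀ *ᵥ q)) := by
    rw [← Matrix.mulVec_mulVec, hq, Matrix.mulVec_smul, dotProduct_smul, smul_eq_mul]
  simp only [Matrix.sub_mulVec, dotProduct_sub, h1, h2, Matrix.smul_mulVec, dotProduct_smul,
    smul_eq_mul] at h
  have hp := Complex.lt_def.1 (hQ.posDef.dotProduct_mulVec_pos hne)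
  have hn := Complex.le_def.1 (((Matrix.posSemidef_self_mul_conjTranspose Q.ϑ₁).add
    (Matrix.posSemidef_self_mul_conjTranspose Q.ϑ₂)).dotProduct_mulVec_nonneg q)
  -- The imaginary part reads `-2 Im z (q* S₀ q) = q* (ϑ₁ ϑ₁* + ϑ₂ ϑ₂*) q`, whose left side is
  -- negative and right side nonnegative.
  have him := congrArg Complex.im h
  simp only [star_def, sub_im, mul_im, conj_re, conj_im, I_re, I_im, zero_mul, zero_add,
    one_mul, ← hp.2, zero_im, zero_re, mul_zero] at him hp hn
  nlinarith [mul_pos hz hp.1]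

/-- The explicit solution is square integrable, so its whole initial value vanishes, that is, `w = i
Λ* q` at `x = 0`. The last two terms of the intertwining relation then cancel, leaving `α* q = z q`,
which forces `q = S₀⁻¹ g = 0`. -/
theorem IsAdmissible.eq_zero_of_upper_initial_eq_zero (hQ : Q.IsAdmissible) {M : ℝ} (hM : 0 < M)
    (hv : IsBoundedBy Q.potential M) {z : ℂ} (hz : M < z.im) {c : Fin m₁ → ℂ}
    {g r : Fin n → ℂ} (h : Q.α *ᵥ g - z • g = Q.ϑ₁ *ᵥ c) (hg : g = Q.gramian 1 *ᵥ r)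
    (h0 : c - I • (Q.ϑ₁ᴴ *ᵥ (Q.S₀⁻¹ *ᵥ g)) = 0) : c = 0 ∧ g = 0 := by
  have hz0 : 0 < z.im := hM.trans hz
  have h' : Q.α * Matrix.replicateCol Unit g - z • Matrix.replicateCol Unit g =
      Q.ϑ₁ * Matrix.replicateCol Unit c := by
    rw [← Matrix.replicateCol_mulVec, ← Matrix.replicateCol_smul, ← Matrix.replicateCol_mulVec,
      ← h]
    rfl
  have hg' : Matrix.replicateCol Unit g = Q.gramian 1 * Matrix.replicateCol Unit r := by
    rw [← Matrix.replicateCol_mulVec, ← hg]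
  have hY := eq_zero_of_integrableOn hv hz
    (fun x hx => (hQ.hasDerivAt_explicitSolution h' hx).hasDerivWithinAt)
    (hQ.integrableOn_explicitSolution hz0 h' hg') (by
      intro i a
      rw [explicitSolution_zero, Matrix.fromRows_apply_inl]
      have := congrFun h0 i
      rw [← Matrix.replicateCol_mulVec, ← Matrix.replicateCol_mulVec]
      simpa using this)
  have hk := hQ.conjTranspose_α_mul h' le_rfl
  rw [explicitSolution, sub_eq_zero] at hY
  rw [hY, Matrix.mul_smul, Matrix.mul_smul, add_sub_cancel_right] at hk
  have e : (Q.S 0)⁻¹ * Q.evolution z (Matrix.replicateCol Unit g) 0 =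
      Matrix.replicateCol Unit (Q.S₀⁻¹ *ᵥ g) := by
    rw [S_zero, evolution, neg_zero, flow_zero, Matrix.replicateCol_mulVec]
    simp
  rw [e, ← Matrix.replicateCol_mulVec, ← Matrix.replicateCol_smul] at hk
  have hq := hQ.eq_zero_of_conjTranspose_α_mulVec hz0 (Matrix.replicateCol_injective hk)
  refine ⟨?_, ?_⟩
  · simpa [hq] using h0
  · have := congrArg (fun q => Q.S₀ *ᵥ q) hq
    simp only [Matrix.mulVec_mulVec, Matrix.mulVec_zero] at this
    rwa [← Q.S_zero, hQ.S_mul_inv le_rfl, Matrix.one_mulVec] at this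

/-- Every upper initial value extends to that of a decaying explicit solution. -/
theorem IsAdmissible.exists_decaying_vector (hQ : Q.IsAdmissible) {M : ℝ} (hM : 0 < M)
    (hv : IsBoundedBy Q.potential M) {z : ℂ} (hz : M < z.im) (f : Fin m₁ → ℂ) :
    ∃ (c : Fin m₁ → ℂ) (r : Fin n → ℂ),
      Q.α *ᵥ (Q.gramian 1 *ᵥ r) - z • (Q.gramian 1 *ᵥ r) = Q.ϑ₁ *ᵥ c ∧
      c - I • (Q.ϑ₁ᴴ *ᵥ (Q.S₀⁻¹ *ᵥ (Q.gramian 1 *ᵥ r))) = f := by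
  set W := LinearMap.range (Q.gramian 1).mulVecLin with hW
  let A : W →ₗ[ℂ] W := Q.α.mulVecLin.restrict fun g hg => α_mulVec_mem_range_gramian hg
  let B : (Fin m₁ → ℂ) →ₗ[ℂ] W := Q.ϑ₁.mulVecLin.codRestrict W ϑ₁_mulVec_mem_range_gramian
  let T : (Fin m₁ → ℂ) × W →ₗ[ℂ] W :=
    (A - z • LinearMap.id).comp (LinearMap.snd ℂ _ _) - B.comp (LinearMap.fst ℂ _ _)
  let P : (Fin m₁ → ℂ) × W →ₗ[ℂ] (Fin m₁ → ℂ) := LinearMap.fst ℂ _ _ -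
    I • (Q.ϑ₁ᴴ.mulVecLin ∘ₗ Q.S₀⁻¹.mulVecLin ∘ₗ W.subtype ∘ₗ LinearMap.snd ℂ _ _)
  have hT : ∀ p : (Fin m₁ → ℂ) × W, p ∈ LinearMap.ker T →
      Q.α *ᵥ (p.2 : Fin n → ℂ) - z • (p.2 : Fin n → ℂ) = Q.ϑ₁ *ᵥ p.1 := by
    intro p hp
    have := congrArg (Subtype.val) (LinearMap.mem_ker.1 hp)
    exact sub_eq_zero.1 this
  let F : LinearMap.ker T →ₗ[ℂ] (Fin m₁ → ℂ) := P ∘ₗ (LinearMap.ker T).subtype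
  have hinj : Function.Injective F := by
    rw [injective_iff_map_eq_zero]
    rintro ⟨⟨c, g, r, hr⟩, hp⟩ h0
    obtain ⟨rfl, rfl⟩ := hQ.eq_zero_of_upper_initial_eq_zero hM hv hz (hT _ hp) hr.symm h0
    rfl
  -- `T` maps a space of dimension `m₁ + dim W` into `W`, so its kernel has dimension at least `m₁`;
  -- injectivity of `F` gives the reverse bound. This includes the case where `z` is an eigenvalue
  -- of `α`.
  have hdim : Module.finrank ℂ (LinearMap.ker T) = Module.finrank ℂ (Fin m₁ → ℂ) := by
    refine le_antisymm (LinearMap.finrank_le_finrank_of_injective hinj) ?_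
    have h1 := LinearMap.finrank_range_add_finrank_ker T
    have h2 := Submodule.finrank_le (LinearMap.range T)
    rw [Module.finrank_prod] at h1
    omega
  have hsurj : LinearMap.range F = ⊤ :=
    Submodule.eq_top_of_finrank_eq ((LinearMap.finrank_range_of_inj hinj).trans hdim)
  obtain ⟨⟨⟨c, g, r, hr⟩, hp⟩, hf⟩ := LinearMap.range_eq_top.1 hsurj f
  have hr' : Q.gramian 1 *ᵥ r = g := hr
  refine ⟨c, r, ?_, ?_⟩
  · rw [hr']
    exact hT _ hp
  · rw [hr']
    exact hf

theorem IsAdmissible.exists_decaying (hQ : Q.IsAdmissible) {M : ℝ} (hM : 0 < M)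
    (hv : IsBoundedBy Q.potential M) {z : ℂ} (hz : M < z.im) :
    ∃ (C : Matrix (Fin m₁) (Fin m₁) ℂ) (G R : Matrix (Fin n) (Fin m₁) ℂ),
      Q.α * G - z • G = Q.ϑ₁ * C ∧ G = Q.gramian 1 * R ∧
      C - I • (Q.ϑ₁ᴴ * (Q.S₀⁻¹ * G)) = 1 := by
  choose c r h1 h2 using fun j : Fin m₁ =>
    hQ.exists_decaying_vector hM hv hz (Pi.single j 1)
  refine ⟨(Matrix.of c)ᵀ, Q.gramian 1 * (Matrix.of r)ᵀ, (Matrix.of r)ᵀ, ?_, rfl, ?_⟩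
  · ext i j
    have := congrFun (h1 j) i
    rw [← Matrix.mul_assoc]
    simp only [Matrix.mulVec_mulVec] at this
    exact this
  · ext i j
    have := congrFun (h2 j) i
    rw [← Matrix.mul_assoc, ← Matrix.mul_assoc]
    simp only [Matrix.mulVec_mulVec, ← Matrix.mul_assoc] at this
    rw [Matrix.one_apply, ← Pi.single_apply]
    exact this

end Quadruple
end SkewDirac

/-! ### Meromorphy of the resolvent -/

theorem differentiable_det_of_entries {n : Type*} [Fintype n] [DecidableEq n]
    {A : ℂ → Matrix n n ℂ} (hA : ∀ i j, Differentiable ℂ fun z => A z i j) :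
    Differentiable ℂ fun z => (A z).det := by
  simp only [Matrix.det_apply]
  refine Differentiable.fun_sum fun σ _ => Differentiable.const_smul ?_ _
  exact Differentiable.fun_finsetProd fun i _ => hA _ _

theorem differentiable_adjugate_apply {n : Type*} [Fintype n] [DecidableEq n]
    {A : ℂ → Matrix n n ℂ} (hA : ∀ i j, Differentiable ℂ fun z => A z i j) (i j : n) :
    Differentiable ℂ fun z => (A z).adjugate i j := by
  simp only [Matrix.adjugate_apply]
  refine differentiable_det_of_entries fun k l => ?_
  by_cases hk : k = j
  · subst hk
    simp only [Matrix.updateRow_self]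
    exact differentiable_const _
  · simp only [Matrix.updateRow_ne hk]
    exact hA k l

theorem meromorphicAt_matrix {m n : Type*} [Fintype m] [Fintype n] [DecidableEq m]
    [DecidableEq n] {A : ℂ → Matrix m n ℂ} {x : ℂ}
    (hA : ∀ i j, MeromorphicAt (fun z => A z i j) x) : MeromorphicAt A x := by
  have e : A = fun z => ∑ i, ∑ j, A z i j • (Matrix.single i j 1 : Matrix m n ℂ) := by
    funext z
    conv_lhs => rw [Matrix.matrix_eq_sum_single (A z)]
    simp [Matrix.smul_single]
  rw [e]
  exact MeromorphicAt.fun_sum fun i _ => MeromorphicAt.fun_sum fun j _ =>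
    (hA i j).smul (MeromorphicAt.const _ x)

/-- By Cramer's rule the entries of the resolvent are quotients of the entire functions given by the
adjugate and the determinant. -/
theorem meromorphicAt_mul_resolvent_mul {l m n : Type*} [Fintype l] [Fintype m] [Fintype n]
    [DecidableEq l] [DecidableEq m] [DecidableEq n] (A : Matrix n n ℂ) (B : Matrix l n ℂ)
    (C : Matrix n m ℂ) (x : ℂ) :
    MeromorphicAt (fun z => B * (z • (1 : Matrix n n ℂ) - A)⁻¹ * C) x := by
  have hent : ∀ i j, Differentiable ℂ fun z : ℂ => (z • (1 : Matrix n n ℂ) - A) i j := by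
    intro i j
    simp only [Matrix.sub_apply, Matrix.smul_apply, smul_eq_mul]
    fun_prop
  have hinv : ∀ i j, MeromorphicAt (fun z : ℂ => (z • (1 : Matrix n n ℂ) - A)⁻¹ i j) x := by
    intro i j
    simp only [Matrix.inv_def, Ring.inverse_eq_inv', Matrix.smul_apply, smul_eq_mul]
    exact ((differentiable_det_of_entries hent).analyticAt x).meromorphicAt.fun_inv.mul
      ((differentiable_adjugate_apply hent i j).analyticAt x).meromorphicAt
  refine meromorphicAt_matrix fun i j => ?_
  simp only [Matrix.mul_apply]
  exact MeromorphicAt.fun_sum fun k _ => (MeromorphicAt.fun_sum fun p _ =>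
    (MeromorphicAt.const _ x).mul (hinv p k)).mul (MeromorphicAt.const _ x)

/-! ### The Weyl function -/

namespace SkewDirac

open Complex MeasureTheory

namespace Quadruple

variable {n m₁ m₂ : ℕ} {Q : Quadruple n m₁ m₂}

/-- Multiplying the normalization by `ϑ₁` and inserting `ϑ₁ C = (α - z) G` eliminates `C` and leaves
`(z - α^×) G = -ϑ₁`. -/
theorem lower_eq_of_notMem_spectrum {z : ℂ} (hz : z ∉ spectrum ℂ Q.αCross)
    {C : Matrix (Fin m₁) (Fin m₁) ℂ} {G : Matrix (Fin n) (Fin m₁) ℂ}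
    (h : Q.α * G - z • G = Q.ϑ₁ * C) (h1 : C - I • (Q.ϑ₁ᴴ * (Q.S₀⁻¹ * G)) = 1) :
    -(I • (Q.ϑ₂ᴴ * (Q.S₀⁻¹ * G))) = I •
      (Q.ϑ₂ᴴ * Q.S₀⁻¹ * (z • (1 : Matrix (Fin n) (Fin n) ℂ) - Q.αCross)⁻¹ * Q.ϑ₁) := by
  have hu : IsUnit (z • (1 : Matrix (Fin n) (Fin n) ℂ) - Q.αCross) := by
    have := spectrum.notMem_iff.1 hz
    rwa [Algebra.algebraMap_eq_smul_one] at this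
  have hG : (z • (1 : Matrix (Fin n) (Fin n) ℂ) - Q.αCross) * G = -Q.ϑ₁ := by
    have h2 : Q.ϑ₁ * C - I • (Q.ϑ₁ * (Q.ϑ₁ᴴ * (Q.S₀⁻¹ * G))) = Q.ϑ₁ := by
      rw [← Matrix.mul_smul, ← Matrix.mul_sub, h1, Matrix.mul_one]
    rw [← h] at h2
    refine Eq.trans ?_ (congrArg Neg.neg h2)
    rw [αCross]
    simp only [Matrix.sub_mul, Matrix.smul_mul, Matrix.one_mul, Matrix.mul_assoc]
    abel
  have hG' : G = -((z • (1 : Matrix (Fin n) (Fin n) ℂ) - Q.αCross)⁻¹ * Q.ϑ₁) := by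
    rw [← Matrix.mul_neg, ← hG, ← Matrix.mul_assoc, Matrix.nonsing_inv_mul _
      ((Matrix.isUnit_iff_isUnit_det _).1 hu), Matrix.one_mul]
  rw [hG']
  simp [Matrix.mul_assoc]

/-- The Weyl solution and the decaying explicit solution are both square integrable with upper
initial value `I`. The uniqueness theorem applied to their difference equates the lower initial
values. -/
theorem IsAdmissible.eq_of_isWeylFunction (hQ : Q.IsAdmissible) {M : ℝ} (hM : 0 < M)
    (hv : IsBoundedBy Q.potential M) {φ : ℂ → Matrix (Fin m₂) (Fin m₁) ℂ}
    (hφ : IsWeylFunction Q.potential M φ) {z : ℂ} (hz : z ∈ upperHalf M)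
    (hzs : z ∉ spectrum ℂ Q.αCross) :
    φ z = I •
      (Q.ϑ₂ᴴ * Q.S₀⁻¹ * (z • (1 : Matrix (Fin n) (Fin n) ℂ) - Q.αCross)⁻¹ * Q.ϑ₁) := by
  obtain ⟨C, G, R, h, hG, h1⟩ := hQ.exists_decaying hM hv hz
  rw [← lower_eq_of_notMem_spectrum hzs h h1]
  obtain ⟨u, hu, hint⟩ := hφ.integrable
  set A : Matrix (Fin m₁ ⊕ Fin m₂) (Fin m₁) ℂ := Matrix.fromRows 1 (φ z) with hA
  have hd1 : ∀ x, 0 ≤ x → HasDerivWithinAt (fun x => u x z * A)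
      (coefficient Q.potential x z * (u x z * A)) (Set.Ici 0) x :=
    fun x hx => hu.hasDerivWithinAt_mul A hx
  have hd2 := fun x (hx : 0 ≤ x) =>
    (hQ.hasDerivAt_explicitSolution h hx).hasDerivWithinAt (s := Set.Ici 0)
  have hi1 : ∀ i a, IntegrableOn (fun x => ‖(u x z * A) i a‖ ^ 2) (Set.Ici 0) := by
    rw [← integrableOn_conjTranspose_mul_self_iff fun x hx => (hd1 x hx).continuousWithinAt]
    refine (hint z hz).congr_fun (fun x _ => ?_) measurableSet_Ici
    simp only [Matrix.conjTranspose_mul, hA,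
      Matrix.conjTranspose_fromRows_eq_fromCols_conjTranspose, Matrix.conjTranspose_one,
      Matrix.mul_assoc]
  have hi2 := hQ.integrableOn_explicitSolution (hM.trans hz) h hG
  have hD : ∀ x, 0 ≤ x → HasDerivWithinAt (fun x => u x z * A - Q.explicitSolution z C G x)
      (coefficient Q.potential x z * (u x z * A - Q.explicitSolution z C G x))
      (Set.Ici 0) x := by
    intro x hx
    refine ((hd1 x hx).sub (hd2 x hx)).congr_deriv ?_
    rw [Matrix.mul_sub]
  have h0 := eq_zero_of_integrableOn hv hz hD (by
    intro i a
    refine Integrable.mono' (((hi1 i a).const_mul 2).add ((hi2 i a).const_mul 2)) ?_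
      (.of_forall fun x => ?_)
    · refine ContinuousOn.aestronglyMeasurable (fun x hx => ?_) measurableSet_Ici
      exact ((continuous_id.matrix_elem i a).continuousAt.comp_continuousWithinAt
        (hD x hx).continuousWithinAt).norm.pow 2
    · rw [Real.norm_of_nonneg (by positivity), Matrix.sub_apply, Pi.add_apply]
      have := norm_sub_le ((u x z * A) i a) (Q.explicitSolution z C G x i a)
      have h3 := norm_nonneg ((u x z * A) i a - Q.explicitSolution z C G x i a)
      nlinarith [sq_nonneg (‖(u x z * A) i a‖ - ‖Q.explicitSolution z C G x i a‖)]) (by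
    intro i a
    rw [hu.initial, Matrix.one_mul, explicitSolution_zero, h1, hA]
    simp)
  simp only [hu.initial, Matrix.one_mul, explicitSolution_zero, h1, hA] at h0
  rw [sub_eq_zero] at h0
  exact (Matrix.fromRows_ext_iff _ _ _ _ |>.1 h0).2

theorem IsAdmissible.exists_isWeylFunction (hQ : Q.IsAdmissible) {M : ℝ} (hM : 0 < M)
    (hv : IsBoundedBy Q.potential M) :
    ∃ φ : ℂ → Matrix (Fin m₂) (Fin m₁) ℂ, IsWeylFunction Q.potential M φ := by
  obtain ⟨u, hu⟩ := exists_isFundamentalSolution hQ.continuousOn_potential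
  choose! C G R h hG h1 using fun z (hz : z ∈ upperHalf M) => hQ.exists_decaying hM hv hz
  -- Taking the lower initial value itself, not the resolvent formula, keeps the integrability valid
  -- at points of `σ(α^×)`, where the matrix inverse takes its default value `0`.
  refine ⟨fun z => -(I • (Q.ϑ₂ᴴ * (Q.S₀⁻¹ * G z))), ?_, u, hu, ?_⟩
  · intro z hz
    have hm : MeromorphicAt (fun z => I • (Q.ϑ₂ᴴ * Q.S₀⁻¹ *
        (z • (1 : Matrix (Fin n) (Fin n) ℂ) - Q.αCross)⁻¹ * Q.ϑ₁)) z :=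
      (MeromorphicAt.const I z).smul (meromorphicAt_mul_resolvent_mul _ _ _ z)
    refine hm.congr ?_
    have hopen : IsOpen (upperHalf M) := isOpen_lt continuous_const Complex.continuous_im
    have hfin : (spectrum ℂ Q.αCross).Finite := Matrix.finite_spectrum _
    -- The spectrum is finite, so the lower initial value agrees with the resolvent formula on a
    -- punctured neighbourhood of `z`, which is all that meromorphy at `z` depends on.
    have hev : ∀ᶠ w in nhdsWithin z {z}ᶜ, w ∉ spectrum ℂ Q.αCross := by
      have : ((spectrum ℂ Q.αCross) \ {z})ᶜ ∈ nhds z :=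
        (hfin.subset Set.sdiff_subset).isClosed.isOpen_compl.mem_nhds (by simp)
      filter_upwards [mem_nhdsWithin_of_mem_nhds this, self_mem_nhdsWithin] with w hw hw' hws
      exact hw ⟨hws, hw'⟩
    filter_upwards [hev, mem_nhdsWithin_of_mem_nhds (hopen.mem_nhds hz)] with w hw hwM
    exact (lower_eq_of_notMem_spectrum hw (h w hwM) (h1 w hwM)).symm
  · intro z hz
    set A : Matrix (Fin m₁ ⊕ Fin m₂) (Fin m₁) ℂ :=
      Matrix.fromRows 1 (-(I • (Q.ϑ₂ᴴ * (Q.S₀⁻¹ * G z)))) with hA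
    have hd1 : ∀ x, 0 ≤ x → HasDerivWithinAt (fun x => u x z * A)
        (coefficient Q.potential x z * (u x z * A)) (Set.Ici 0) x :=
      fun x hx => hu.hasDerivWithinAt_mul A hx
    have hd2 := fun x (hx : 0 ≤ x) =>
      (hQ.hasDerivAt_explicitSolution (h z hz) hx).hasDerivWithinAt (s := Set.Ici 0)
    have heq : ∀ x, 0 ≤ x → u x z * A = Q.explicitSolution z (C z) (G z) x := by
      intro x hx
      have := eq_zero_of_initial_eq_zero hQ.continuousOn_potential
        (D := fun x => u x z * A - Q.explicitSolution z (C z) (G z) x) (z := z)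
        (fun x hx => ((hd1 x hx).sub (hd2 x hx)).congr_deriv (by rw [Matrix.mul_sub]))
        (by
          simp only [hu.initial, Matrix.one_mul, explicitSolution_zero, h1 z hz, hA]
          exact sub_self _) hx
      exact sub_eq_zero.1 this
    have hi := (integrableOn_conjTranspose_mul_self_iff fun x hx =>
      (hd2 x hx).continuousWithinAt).2
      (hQ.integrableOn_explicitSolution (hM.trans hz) (h z hz) (hG z hz))
    refine hi.congr_fun (fun x hx => ?_) measurableSet_Ici
    simp only [← heq x hx, Matrix.conjTranspose_mul, hA,
      Matrix.conjTranspose_fromRows_eq_fromCols_conjTranspose, Matrix.conjTranspose_one,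
      Matrix.mul_assoc]

end Quadruple
end SkewDirac

end

theorem theorem2p5 {n m₁ m₂ : ℕ} (Q : SkewDirac.Quadruple n m₁ m₂) (hQ : Q.IsAdmissible) :
    (∃ M : ℝ, 0 < M ∧ SkewDirac.IsBoundedBy Q.potential M) ∧
    ∀ M : ℝ, 0 < M → SkewDirac.IsBoundedBy Q.potential M →
      (∃ φ : ℂ → Matrix (Fin m₂) (Fin m₁) ℂ, SkewDirac.IsWeylFunction Q.potential M φ) ∧
      ∀ φ : ℂ → Matrix (Fin m₂) (Fin m₁) ℂ, SkewDirac.IsWeylFunction Q.potential M φ →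
        ∀ z ∈ SkewDirac.upperHalf M, z ∉ spectrum ℂ Q.αCross →
          φ z = Complex.I •
            (Q.ϑ₂ᴴ * Q.S₀⁻¹ * (z • (1 : Matrix (Fin n) (Fin n) ℂ) - Q.αCross)⁻¹ * Q.ϑ₁) := by
  exact ⟨hQ.exists_isBoundedBy, fun M hM hv => ⟨hQ.exists_isWeylFunction hM hv,
    fun φ hφ z hz hzs => hQ.eq_of_isWeylFunction hM hv hφ hz hzs⟩⟩
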